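/- Let $\mathcal C$ be the set of locally finite subsets of $\mathbb R^d$, with the $\sigma$-field generated by the counting functions $N_\Lambda(\gamma)=\#(\gamma\cap\Lambda)$ ($\Lambda$ bounded measurable), and let $\mathcal C_f\subset\mathcal C$ be the finite configurations. Write $\gamma_\Lambda=\gamma\cap\Lambda$. Let $H:\mathcal C_f\to\mathbb R\cup\{+\infty\}$ be an energy function: $H$ is measurable, $H(\emptyset)<\infty$, $H(\gamma)<\infty$ implies $H(\gamma\setminus\{x\})<\infty$ for $x\in\gamma$, and there is $A\in\mathbb R$ with $H(\gamma)\ge A\,\#\gamma$ for all $\gamma\in\mathcal C_f$. Assume that $H$ is translation invariant and has finite range $R>0$: for every bounded $\Delta$ and $\gamma\in\mathcal C_f$, the local energy $H_\Delta(\gamma):=H(\gamma)-H(\gamma_{\Delta^c})$ (with $\infty-\infty=0$) satisfies $H_\Delta(\gamma)=H_\Delta(\gamma_{\Delta\oplus B(0,R)})$, where $B(x,R)$ is the closed ball. This identity extends $H_\Delta$ to $\mathcal C$. Likewise let $h(x,\gamma)=H(\{x\}\cup\gamma)-H(\gamma)$ for $\gamma\in\mathcal C_f$ (with $\infty-\infty=0$),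 extended to $\gamma\in\mathcal C$ by $h(x,\gamma)=h(x,\gamma_{B(x,R)})$. Let $z>0$, $\beta\ge0$, and let $\Gamma$ be an (infinite volume) Gibbs point process with energy $H$, activity $z$ and inverse temperature $\beta$: a random element of $\mathcal C$ whose law $P$ is stationary and such that, for every bounded measurable $\Delta\subset\mathbb R^d$ of positive Lebesgue measure, for $P$-almost every $\gamma_{\Delta^c}$, $$P(d\gamma_\Delta\mid\gamma_{\Delta^c})=\frac1{Z_\Delta(\gamma_{\Delta^c})}\,z^{N_\Delta(\gamma)}e^{-\beta H_\Delta(\gamma)}\,\pi_\Delta(d\gamma_\Delta),$$ where $\pi_\Delta$ is the law of the Poisson point process of intensity $1$ in $\Delta$ and $Z_\Delta(\gamma_{\Delta^c})$ is the normalizing constant. Assume that for every $\gamma\in\mathcal C$ the function $x\mapsto h(x,\gamma)$ is (finite and) differentiable on $\mathbb R^d\setminus\gamma$. Let $f:\mathbb R^d\times\mathcal C\to\mathbb R$ be measurable and such that, for every $\gamma\in\mathcal C$, the function $x\mapsto f(x,\gamma)$ is differentiable on $\mathbb R^d$ with compact support. Assume moreover the integrability $$E\sum_{x\in\Gamma}\bigl|\nabla_xf(x,\Gamma\setminus\{x\})\bigr|<\infty,\qquad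 E\sum_{x\in\Gamma}\bigl|f(x,\Gamma\setminus\{x\})\,\nabla_xh(x,\Gamma\setminus\{x\})\bigr|<\infty .$$ Then $$E\Bigl(\sum_{x\in\Gamma}\nabla_xf(x,\Gamma\setminus\{x\})\Bigr)=\beta\,E\Bigl(\sum_{x\in\Gamma}f(x,\Gamma\setminus\{x\})\,\nabla_xh(x,\Gamma\setminus\{x\})\Bigr).$$ -/

import Mathlib

open MeasureTheory Set
open scoped ENNReal Pointwise Nat

noncomputable section

namespace GibbsPP

/-- The space of locally finite subsets of `ℝ^d`. -/
def Config (d : ℕ) : Type :=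
  {γ : Set (EuclideanSpace ℝ (Fin d)) // ∀ Λ, Bornology.IsBounded Λ → (γ ∩ Λ).Finite}

namespace Config

variable {d : ℕ}

/-- The counting function `N_Λ(γ) = #(γ ∩ Λ)`. It is used for bounded `Λ` or finite `γ` only. -/
def count (Λ : Set (EuclideanSpace ℝ (Fin d))) (γ : Config d) : ℕ := (γ.1 ∩ Λ).ncard

/-- The sigma-field generated by the counting functions of bounded measurable sets. -/
instance : MeasurableSpace (Config d) :=
  ⨆ (Λ : Set (EuclideanSpace ℝ (Fin d))) (_ : MeasurableSet Λ) (_ : Bornology.IsBounded Λ),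
    MeasurableSpace.comap (count Λ) ⊤

/-- The restriction `γ_Λ = γ ∩ Λ`. -/
def restrict (γ : Config d) (Λ : Set (EuclideanSpace ℝ (Fin d))) : Config d :=
  ⟨γ.1 ∩ Λ, fun Δ hΔ => (γ.2 Δ hΔ).subset (by
    rintro x ⟨⟨h1, _⟩, h2⟩; exact ⟨h1, h2⟩)⟩

/-- The union `γ ∪ η`. -/
def union (γ η : Config d) : Config d :=
  ⟨γ.1 ∪ η.1, fun Δ hΔ => by
    rw [Set.union_inter_distrib_right]; exact (γ.2 Δ hΔ).union (η.2 Δ hΔ)⟩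

/-- The configuration `γ \ {x}`. -/
def erase (γ : Config d) (x : EuclideanSpace ℝ (Fin d)) : Config d := γ.restrict {x}ᶜ

/-- The configuration `{x} ∪ γ`. -/
def insert (x : EuclideanSpace ℝ (Fin d)) (γ : Config d) : Config d :=
  ⟨{x} ∪ γ.1, fun Δ hΔ => by
    rw [Set.union_inter_distrib_right]
    exact ((Set.finite_singleton x).inter_of_left Δ).union (γ.2 Δ hΔ)⟩

/-- The translate `τ_u(γ) = {x + u : x ∈ γ}`. -/
def translate (u : EuclideanSpace ℝ (Fin d)) (γ : Config d) : Config d :=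
  ⟨(fun x => x + u) '' γ.1, fun Δ hΔ => by
    have hb : Bornology.IsBounded ((fun x => x + -u) '' Δ) := by
      have h := hΔ.add (Bornology.isBounded_singleton (x := -u))
      rwa [Set.add_singleton] at h
    refine ((γ.2 _ hb).image (fun x => x + u)).subset ?_
    rintro y ⟨⟨x, hx, rfl⟩, hy⟩
    exact ⟨x, ⟨hx, ⟨x + u, hy, by simp⟩⟩, rfl⟩⟩

/-- The configuration `{x₁, …, xₙ}`. -/
def ofPoints {n : ℕ} (x : Fin n → EuclideanSpace ℝ (Fin d)) : Config d :=
  ⟨Set.range x, fun Δ _ => (Set.finite_range x).inter_of_left Δ⟩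

theorem measurable_count {Λ : Set (EuclideanSpace ℝ (Fin d))} (hΛ : MeasurableSet Λ)
    (hb : Bornology.IsBounded Λ) : Measurable (count Λ) := by
  rw [measurable_iff_comap_le]
  exact le_iSup_of_le Λ (le_iSup_of_le hΛ (le_iSup_of_le hb le_rfl))

theorem measurable_of_count {α : Type*} [MeasurableSpace α] {g : α → Config d}
    (h : ∀ Λ, MeasurableSet Λ → Bornology.IsBounded Λ → Measurable fun a => count Λ (g a)) :
    Measurable g := by
  rw [measurable_iff_comap_le]
  simp only [instMeasurableSpace, MeasurableSpace.comap_iSup, MeasurableSpace.comap_comp]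
  exact iSup_le fun Λ => iSup_le fun hΛ => iSup_le fun hb =>
    measurable_iff_comap_le.1 (h Λ hΛ hb)

theorem count_ofPoints {n : ℕ} (Λ : Set (EuclideanSpace ℝ (Fin d)))
    (x : Fin n → EuclideanSpace ℝ (Fin d)) :
    count Λ (ofPoints x) =
      ∑ i, Set.indicator {y : Fin n → EuclideanSpace ℝ (Fin d) | y i ∈ Λ ∧ ∀ j < i, y j ≠ y i}
        (fun _ => 1) x := by
  classical
  have h1 : (Set.range x ∩ Λ) =
      x '' (↑(Finset.univ.filter fun i => x i ∈ Λ ∧ ∀ j < i, x j ≠ x i) : Set (Fin n)) := by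
    ext y
    constructor
    · rintro ⟨⟨i, rfl⟩, hi⟩
      have hne : (Finset.univ.filter fun j => x j = x i).Nonempty := ⟨i, by simp⟩
      refine ⟨(Finset.univ.filter fun j => x j = x i).min' hne, ?_, ?_⟩
      · have hm := Finset.min'_mem _ hne
        simp only [Finset.mem_filter, Finset.mem_univ, true_and] at hm
        simp only [Finset.coe_filter, Finset.mem_univ, true_and, Set.mem_ofPred_eq]
        refine ⟨by rw [hm]; exact hi, fun j hj hxj => ?_⟩
        have := Finset.min'_le (Finset.univ.filter fun j => x j = x i) j (by simp [hxj, hm])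
        exact absurd hj (not_lt.2 this)
      · have hm := Finset.min'_mem _ hne
        simpa using hm
    · rintro ⟨i, hi, rfl⟩
      simp only [Finset.coe_filter, Finset.mem_univ, true_and, Set.mem_ofPred_eq] at hi
      exact ⟨⟨i, rfl⟩, hi.1⟩
  have h2 : Set.InjOn x
      (↑(Finset.univ.filter fun i => x i ∈ Λ ∧ ∀ j < i, x j ≠ x i) : Set (Fin n)) := by
    intro i hi j hj hij
    simp only [Finset.coe_filter, Finset.mem_univ, true_and, Set.mem_ofPred_eq] at hi hj
    rcases lt_trichotomy i j with h | h | h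
    · exact absurd hij (hj.2 i h)
    · exact h
    · exact absurd hij.symm (hi.2 j h)
  change (Set.range x ∩ Λ).ncard = _
  rw [h1, h2.ncard_image, Set.ncard_coe_finset, Finset.card_filter]
  exact Finset.sum_congr rfl fun i _ => by simp [Set.indicator_apply]

theorem measurable_ofPoints (n : ℕ) :
    Measurable (ofPoints : (Fin n → EuclideanSpace ℝ (Fin d)) → Config d) := by
  refine measurable_of_count fun Λ hΛ _ => ?_
  simp only [count_ofPoints]
  refine Finset.measurable_sum _ fun i _ => measurable_const.indicator ?_
  have : {y : Fin n → EuclideanSpace ℝ (Fin d) | y i ∈ Λ ∧ ∀ j < i, y j ≠ y i} =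
      (fun y => y i) ⁻¹' Λ ∩ ⋂ j, ⋂ (_ : j < i), {y | y j = y i}ᶜ := by
    ext y; simp
  rw [this]
  exact (measurable_pi_apply i hΛ).inter (MeasurableSet.iInter fun j => MeasurableSet.iInter
    fun _ => (measurableSet_eq_fun (measurable_pi_apply j) (measurable_pi_apply i)).compl)

end Config

/-- The space of finite configurations, with the trace sigma-field. -/
abbrev FinConfig (d : ℕ) : Type := {γ : Config d // γ.1.Finite}

namespace FinConfig

variable {d : ℕ}

/-- The empty configuration. -/
def empty : FinConfig d := ⟨⟨∅, fun Δ _ => by simp⟩, Set.finite_empty⟩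

/-- The total number of points. -/
def card (γ : FinConfig d) : ℕ := γ.1.1.ncard

def restrict (γ : FinConfig d) (Λ : Set (EuclideanSpace ℝ (Fin d))) : FinConfig d :=
  ⟨γ.1.restrict Λ, γ.2.inter_of_left Λ⟩

def erase (γ : FinConfig d) (x : EuclideanSpace ℝ (Fin d)) : FinConfig d := γ.restrict {x}ᶜ

def insert (x : EuclideanSpace ℝ (Fin d)) (γ : FinConfig d) : FinConfig d :=
  ⟨Config.insert x γ.1, (Set.finite_singleton x).union γ.2⟩

def translate (u : EuclideanSpace ℝ (Fin d)) (γ : FinConfig d) : FinConfig d :=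
  ⟨Config.translate u γ.1, γ.2.image _⟩

end FinConfig

/-- The finite configuration `γ_Λ` of a configuration `γ` seen in a bounded window `Λ`. -/
def Config.window {d : ℕ} (γ : Config d) (Λ : Set (EuclideanSpace ℝ (Fin d)))
    (hΛ : Bornology.IsBounded Λ) : FinConfig d :=
  ⟨γ.restrict Λ, γ.2 Λ hΛ⟩

/-- Difference of two energies in `ℝ ∪ {+∞}`, with the convention `∞ - ∞ = 0`. -/
def energyDiff (a b : EReal) : EReal := open Classical in if a = ⊤ ∧ b = ⊤ then 0 else a - b

/-- Energy functions `H : C_f → ℝ ∪ {+∞}`: measurable, non-degenerate, hereditary and stable. -/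
structure EnergyFunction (d : ℕ) where
  toFun : FinConfig d → EReal
  ne_bot : ∀ γ, toFun γ ≠ ⊥
  measurable : Measurable toFun
  nondegenerate : toFun FinConfig.empty < ⊤
  hereditary : ∀ (γ : FinConfig d), ∀ x ∈ γ.1.1, toFun γ < ⊤ → toFun (γ.erase x) < ⊤
  stable : ∃ A : ℝ, ∀ γ : FinConfig d, ((A * (γ.card : ℝ) : ℝ) : EReal) ≤ toFun γ

namespace EnergyFunction

variable {d : ℕ} (H : EnergyFunction d)

/-- `H(τ_u γ) = H(γ)` for every vector `u` and every finite configuration `γ`. -/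
def IsStationary : Prop :=
  ∀ (u : EuclideanSpace ℝ (Fin d)) (γ : FinConfig d), H.toFun (γ.translate u) = H.toFun γ

/-- `H_Δ(γ) = H(γ) - H(γ_{Δᶜ})` for a finite configuration. -/
def localEnergyFin (Δ : Set (EuclideanSpace ℝ (Fin d))) (γ : FinConfig d) : EReal :=
  energyDiff (H.toFun γ) (H.toFun (γ.restrict Δᶜ))

/-- Finite range `R`: for every bounded `Δ`, the energy `H_Δ(γ)` depends only on the points of `γ`
in `Δ ⊕ B(0, R)`, that is `H_Δ(γ) = H_Δ(γ_{Δ ⊕ B(0, R)})`. -/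
def HasFiniteRange (R : ℝ) : Prop :=
  ∀ Δ : Set (EuclideanSpace ℝ (Fin d)), Bornology.IsBounded Δ → ∀ γ : FinConfig d,
    H.localEnergyFin Δ γ = H.localEnergyFin Δ (γ.restrict (Δ + Metric.closedBall 0 R))

/-- The extension of `H_Δ` to all configurations when `H` has finite range `R`. -/
def localEnergy (R : ℝ) (Δ : Set (EuclideanSpace ℝ (Fin d))) (hΔ : Bornology.IsBounded Δ)
    (γ : Config d) : EReal :=
  H.localEnergyFin Δ (γ.window (Δ + Metric.closedBall 0 R) (hΔ.add Metric.isBounded_closedBall))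

/-- `h(x, γ) = H({x} ∪ γ) - H(γ)` for a finite configuration. -/
def pointEnergyFin (x : EuclideanSpace ℝ (Fin d)) (γ : FinConfig d) : EReal :=
  energyDiff (H.toFun (FinConfig.insert x γ)) (H.toFun γ)

/-- The extension `h(x, γ) = h(x, γ_{B(x, R)})` to all configurations when `H` has finite
range `R`. -/
def pointEnergy (R : ℝ) (x : EuclideanSpace ℝ (Fin d)) (γ : Config d) : EReal :=
  H.pointEnergyFin x (γ.window (Metric.closedBall x R) Metric.isBounded_closedBall)

end EnergyFunction

/-- The law `π_Δ` of the Poisson point process of unit intensity in `Δ` (`Δ` bounded measurable):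
the number of points is Poisson with parameter `v = λ(Δ)` and, given that it is `n`, the points are
independent and uniform in `Δ`. The two normalisations combine to
`e^{-v} v^n / n! * (λ_Δ / v)^{⊗ n} = e^{-v} / n! * λ_Δ^{⊗ n}`. -/
def poissonLaw {d : ℕ} (Δ : Set (EuclideanSpace ℝ (Fin d))) : Measure (Config d) :=
  Measure.sum fun n : ℕ =>
    ENNReal.ofReal (Real.exp (-(volume Δ).toReal) / (n ! : ℝ)) •
      (Measure.pi fun _ : Fin n => (volume : Measure (EuclideanSpace ℝ (Fin d))).restrict Δ).map
        Config.ofPoints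

section Gibbs

variable {d : ℕ} (H : EnergyFunction d) (R z β : ℝ)

/-- The unnormalised density
`γ' ↦ z^{N_Δ(γ')} exp(-β H_Δ(γ'_Δ ∪ γ_{Δᶜ}))` of the points in `Δ` with respect to `π_Δ`, given the
configuration `γ_{Δᶜ}` outside `Δ`. -/
def gibbsWeight (Δ : Set (EuclideanSpace ℝ (Fin d))) (hΔ : Bornology.IsBounded Δ)
    (γ γ' : Config d) : ℝ≥0∞ :=
  ENNReal.ofReal z ^ γ'.count Δ *
    EReal.exp (-((β : EReal) * H.localEnergy R Δ hΔ ((γ'.restrict Δ).union (γ.restrict Δᶜ))))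

/-- The normalising constant `Z_Δ(γ_{Δᶜ})`. -/
def partitionFunction (Δ : Set (EuclideanSpace ℝ (Fin d))) (hΔ : Bornology.IsBounded Δ)
    (γ : Config d) : ℝ≥0∞ :=
  ∫⁻ γ', gibbsWeight H R z β Δ hΔ γ γ' ∂(poissonLaw Δ)

/-- The probability of the event `A` under
`Z_Δ(γ_{Δᶜ})⁻¹ z^{N_Δ} exp(-β H_Δ) π_Δ(dγ'_Δ)`. -/
def dlrKernel (Δ : Set (EuclideanSpace ℝ (Fin d))) (hΔ : Bornology.IsBounded Δ)
    (γ : Config d) (A : Set (Config d)) : ℝ≥0∞ :=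
  (partitionFunction H R z β Δ hΔ γ)⁻¹ *
    ∫⁻ γ' in A, gibbsWeight H R z β Δ hΔ γ γ' ∂(poissonLaw Δ)

/-- Infinite volume Gibbs measures with activity `z`, inverse temperature `β` and energy `H` of
finite range `R`: stationary probability measures such that, for every bounded measurable `Δ` of
positive volume, the conditional law of `γ_Δ` given `γ_{Δᶜ}` is the kernel above. -/
structure IsGibbsMeasure (P : Measure (Config d)) : Prop where
  isProbabilityMeasure : IsProbabilityMeasure P
  stationary : ∀ u : EuclideanSpace ℝ (Fin d), P.map (Config.translate u) = P
  dlr : ∀ (Δ : Set (EuclideanSpace ℝ (Fin d))) (hΔ : Bornology.IsBounded Δ),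
    MeasurableSet Δ → 0 < volume Δ →
    ∀ A B : Set (Config d), MeasurableSet A → MeasurableSet B →
      P {γ | γ.restrict Δ ∈ A ∧ γ.restrict Δᶜ ∈ B} =
        ∫⁻ γ in {γ | γ.restrict Δᶜ ∈ B}, dlrKernel H R z β Δ hΔ γ A ∂P

end Gibbs

end GibbsPP

end

/-!
The formula is an integration by parts under the Georgii–Nguyen–Zessin (GNZ) equation.

The GNZ equation (`IsGibbsMeasure.campbell_eq`) says that the reduced Campbell measure of a Gibbs
point process, the intensity of the pairs `(x, γ \ {x})` with `x ∈ γ`, has the density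
`z exp(-β h(x, γ))` with respect to `dx P(dγ)`. It follows from the Mecke formula for the Poisson
process (`lintegral_tsum_poissonLaw`), since adding a point `x` to the configuration in `Δ`
multiplies the density of the Gibbs kernel by `z exp(-β h(x, ·))` (`gibbsWeight_insert`); the
normalising constant is never evaluated. Both expectations of the theorem are thereby integrals
against `z exp(-β h(x, γ)) dx P(dγ)`, and their difference is
`z ∫∫ ∇ₓ (f(x, γ) exp(-β h(x, γ))) dx P(dγ)`. It remains to see that the inner integral vanishes for
almost every `γ`.

The function `u = f(·, γ) exp(-β h(·, γ))` has compact support and an integrable gradient, but it is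
differentiable only off `γ`. In dimension at least two almost every line parallel to an axis avoids
the countable set `γ`, and the fundamental theorem of calculus on these lines gives `∫ ∇u = 0`
(`integral_gradient_eq_zero`). In dimension one `u` has one-sided limits at the points of `γ`, and
the integral is minus the sum of the jumps there, so the jumps have to be excluded. For `s ∈ γ` and
`η = γ \ {s}`, the function `h(x, γ) + h(s, η)` of `x` and `s` is the energy cost of adding both
points to `η`, which is symmetric in the two points. If it jumped on the diagonal by a definite amount
at two positions `s < s'` close to each other, its value at `(s, s')` would be seen both from the left
and from the right of the jump, which is impossible. Hence for each `η` only countably many positions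
`s` carry a jump (`countable_of_symmetric_jump`), and by the GNZ equation almost surely no point of
`γ` does (`IsGibbsMeasure.ae_no_jump`). Where `f` vanishes, the local lower bound on `h` given by
stability shows that `u` tends to zero.

All sums over points of a configuration are handled through the counting kernel
`Config.pointKernel`; its s-finiteness gives the measurability of every operation on configurations.
-/

namespace GibbsPP

open ProbabilityTheory Filter
open scoped Topology

local notation "𝔼" d:max => EuclideanSpace ℝ (Fin d)

/-! ### Configurations as counting measures -/

namespace Config

variable {d : ℕ}

theorem countable (γ : Config d) : γ.1.Countable := by
  have h : γ.1 = ⋃ n : ℕ, γ.1 ∩ Metric.closedBall 0 n := by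
    rw [← Set.inter_iUnion, Metric.iUnion_closedBall_nat, Set.inter_univ]
  rw [h]
  exact Set.countable_iUnion fun n => (γ.2 _ Metric.isBounded_closedBall).countable

theorem finite_inter_closedBall (γ : Config d) (x : 𝔼 d) (r : ℝ) :
    (γ.1 ∩ Metric.closedBall x r).Finite :=
  γ.2 _ Metric.isBounded_closedBall

/-- A locally finite set stays away from each point, apart from that point itself. -/
theorem eventually_notMem (γ : Config d) (x : 𝔼 d) : ∀ᶠ y in 𝓝[≠] x, y ∉ γ.1 := by
  have hfin : ((γ.1 ∩ Metric.closedBall x 1) \ {x}).Finite :=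
    (γ.finite_inter_closedBall x 1).subset Set.sdiff_subset
  have h1 : ((γ.1 ∩ Metric.closedBall x 1) \ {x})ᶜ ∈ 𝓝 x :=
    hfin.isClosed.isOpen_compl.mem_nhds (by simp)
  filter_upwards [mem_nhdsWithin_of_mem_nhds h1,
    mem_nhdsWithin_of_mem_nhds (Metric.closedBall_mem_nhds x one_pos),
    self_mem_nhdsWithin] with y hy1 hy2 hy3 hy
  exact hy1 ⟨⟨hy, hy2⟩, hy3⟩

theorem count_restrict_apply (γ : Config d) {Λ : Set (𝔼 d)} (hΛ : MeasurableSet Λ)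
    (hb : Bornology.IsBounded Λ) :
    (Measure.count.restrict γ.1) Λ = (count Λ γ : ℝ≥0∞) := by
  have hfin : (Λ ∩ γ.1).Finite := by rw [Set.inter_comm]; exact γ.2 Λ hb
  rw [Measure.restrict_apply hΛ, Measure.count_apply hfin.measurableSet, Config.count,
    Set.inter_comm γ.1 Λ, ← hfin.cast_ncard_eq]
  rfl

/-- The spherical shell of inner radius `n` and width `1`. -/
def shell (d n : ℕ) : Set (𝔼 d) := {x | ⌊‖x‖⌋₊ = n}

theorem measurableSet_shell (n : ℕ) : MeasurableSet (shell d n) :=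
  (Nat.measurable_floor.comp measurable_norm) (measurableSet_singleton n)

theorem isBounded_shell (n : ℕ) : Bornology.IsBounded (shell d n) := by
  refine (Metric.isBounded_closedBall (x := (0 : 𝔼 d)) (r := n + 1)).subset ?_
  intro x hx
  have hx : ⌊‖x‖⌋₊ = n := hx
  have := Nat.lt_floor_add_one ‖x‖
  rw [hx] at this
  simpa using this.le

/-- The counting measure of the points of `γ` in the `n`-th shell, as a kernel in `γ`. -/
noncomputable def shellKernel (d n : ℕ) : Kernel (Config d) (𝔼 d) where
  toFun γ := (Measure.count.restrict γ.1).restrict (shell d n)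
  measurable' := by
    refine Measure.measurable_of_measurable_coe _ fun Λ hΛ => ?_
    have hm := hΛ.inter (measurableSet_shell (d := d) n)
    have hb : Bornology.IsBounded (Λ ∩ shell d n) := (isBounded_shell n).subset inter_subset_right
    simp_rw [Measure.restrict_apply hΛ, count_restrict_apply _ hm hb]
    exact measurable_from_top.comp (measurable_count hm hb)

instance (n : ℕ) : IsSFiniteKernel (shellKernel d n) := by
  classical
  have hm : ∀ k : ℕ, MeasurableSet {γ : Config d | count (shell d n) γ = k} := fun k =>
    measurable_count (measurableSet_shell n) (isBounded_shell n) (measurableSet_singleton k)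
  have hfin : ∀ k, IsFiniteKernel (Kernel.piecewise (hm k) (shellKernel d n) 0) := fun k => by
    refine ⟨⟨k, by simp, fun γ => ?_⟩⟩
    rw [Kernel.piecewise_apply]
    split_ifs with h
    · change (Measure.count.restrict γ.1).restrict (shell d n) univ ≤ k
      have h : count (shell d n) γ = k := h
      rw [Measure.restrict_apply_univ,
        count_restrict_apply _ (measurableSet_shell n) (isBounded_shell n), h]
    · simp
  have hsum : shellKernel d n =
      Kernel.sum fun k => Kernel.piecewise (hm k) (shellKernel d n) 0 := by
    ext γ Λ hΛ
    rw [Kernel.sum_apply' _ _ hΛ, tsum_eq_single (count (shell d n) γ)]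
    · rw [Kernel.piecewise_apply,
        if_pos (show γ ∈ {η : Config d | count (shell d n) η = count (shell d n) γ} from rfl)]
    · intro k hk
      rw [Kernel.piecewise_apply, 
        if_neg (fun h : γ ∈ {η : Config d | count (shell d n) η = k} => hk (Eq.symm h))]
      simp
  rw [hsum]
  exact Kernel.isSFiniteKernel_sum

/-- The counting measure `∑_{x ∈ γ} δ_x`, as a kernel in the configuration `γ`. -/
noncomputable def pointKernel (d : ℕ) : Kernel (Config d) (𝔼 d) := Kernel.sum (shellKernel d)

instance : IsSFiniteKernel (pointKernel d) := Kernel.isSFiniteKernel_sum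

theorem pointKernel_apply (γ : Config d) : pointKernel d γ = Measure.count.restrict γ.1 := by
  have hdisj : Pairwise (Function.onFun Disjoint (shell d)) := fun i j hij =>
    Set.disjoint_left.2 fun x (hi : ⌊‖x‖⌋₊ = i) (hj : ⌊‖x‖⌋₊ = j) => hij (hi.symm.trans hj)
  have huniv : ⋃ n, shell d n = univ := by
    ext x; simp [shell]
  rw [pointKernel, Kernel.sum_apply]
  change (Measure.sum fun n => (Measure.count.restrict γ.1).restrict (shell d n)) = _
  rw [← Measure.restrict_iUnion hdisj measurableSet_shell, huniv, Measure.restrict_univ]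

theorem lintegral_pointKernel (γ : Config d) (F : 𝔼 d → ℝ≥0∞) :
    ∫⁻ x, F x ∂(pointKernel d γ) = ∑' x : γ.1, F x := by
  rw [pointKernel_apply, lintegral_countable _ γ.countable]
  simp

/-- Sums over the points of a configuration that depends measurably on a parameter are measurable
functions of the parameter. -/
theorem measurable_tsum {α : Type*} [MeasurableSpace α] {g : α → Config d} (hg : Measurable g)
    {F : α × 𝔼 d → ℝ≥0∞} (hF : Measurable F) :
    Measurable fun a => ∑' x : (g a).1, F (a, x) := by
  have h : (fun a => ∑' x : (g a).1, F (a, x)) = fun a => ∫⁻ x, F (a, x) ∂(pointKernel d (g a)) :=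
    funext fun a => (lintegral_pointKernel (g a) fun x => F (a, x)).symm
  rw [h]
  exact Measurable.lintegral_kernel_prod_right (κ := (pointKernel d).comap g hg)
    (f := fun a x => F (a, x)) hF

theorem tsum_indicator_eq_count (γ : Config d) {Λ : Set (𝔼 d)} (hb : Bornology.IsBounded Λ) :
    ∑' x : γ.1, Λ.indicator (fun _ => (1 : ℝ≥0∞)) x = (count Λ γ : ℝ≥0∞) := by
  have hfin : (γ.1 ∩ Λ).Finite := γ.2 Λ hb
  rw [tsum_subtype γ.1 (Λ.indicator fun _ => (1 : ℝ≥0∞)), Set.indicator_indicator,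
    ← tsum_subtype _ fun _ => (1 : ℝ≥0∞), ENNReal.tsum_set_one, Config.count, ← hfin.cast_ncard_eq]
  rfl

/-- A configuration-valued map is measurable as soon as the sums over its points of indicators
of bounded measurable sets are. -/
theorem measurable_of_tsum {α : Type*} [MeasurableSpace α] {g : α → Config d}
    (h : ∀ Λ, MeasurableSet Λ → Bornology.IsBounded Λ →
      Measurable fun a => ∑' x : (g a).1, Λ.indicator (fun _ => (1 : ℝ≥0∞)) (x : 𝔼 d)) :
    Measurable g := by
  refine measurable_of_count fun Λ hΛ hb => ?_
  have h1 := h Λ hΛ hb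
  simp_rw [tsum_indicator_eq_count _ hb] at h1
  have h2 := Nat.measurable_floor.comp h1.ennreal_toReal
  simpa [Function.comp_def] using h2

theorem measurableSet_mem : MeasurableSet {p : 𝔼 d × Config d | p.1 ∈ p.2.1} := by
  have h : Measurable fun p : 𝔼 d × Config d =>
      ∑' x : p.2.1, ({q : (𝔼 d × Config d) × 𝔼 d | q.1.1 = q.2}.indicator
        (fun _ => (1 : ℝ≥0∞))) (p, x) :=
    measurable_tsum measurable_snd (measurable_const.indicator
      (measurableSet_eq_fun (measurable_fst.comp measurable_fst) measurable_snd))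
  have heq : {p : 𝔼 d × Config d | p.1 ∈ p.2.1} = (fun p : 𝔼 d × Config d =>
      ∑' x : p.2.1, ({q : (𝔼 d × Config d) × 𝔼 d | q.1.1 = q.2}.indicator
        (fun _ => (1 : ℝ≥0∞))) (p, x)) ⁻¹' {0}ᶜ := by
    ext ⟨x, γ⟩
    simp [ENNReal.tsum_eq_zero, Set.indicator_apply]
  rw [heq]
  exact h (measurableSet_singleton 0).compl

/-- Thinning a configuration: a map whose value is `{y ∈ g a | (a, y) ∈ T}` is measurable. -/
theorem measurable_of_eq_sep {α : Type*} [MeasurableSpace α] {g g' : α → Config d}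
    (hg : Measurable g) {T : Set (α × 𝔼 d)} (hT : MeasurableSet T)
    (h : ∀ a, (g' a).1 = {y ∈ (g a).1 | (a, y) ∈ T}) : Measurable g' := by
  refine measurable_of_tsum fun Λ hΛ _ => ?_
  have heq : (fun a => ∑' x : (g' a).1, Λ.indicator (fun _ => (1 : ℝ≥0∞)) x) =
      fun a => ∑' x : (g a).1, (T ∩ Prod.snd ⁻¹' Λ).indicator (fun _ => (1 : ℝ≥0∞)) (a, x) := by
    funext a
    rw [tsum_subtype (g' a).1 (Λ.indicator fun _ => (1 : ℝ≥0∞)),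
      tsum_subtype (g a).1 fun x => (T ∩ Prod.snd ⁻¹' Λ).indicator (fun _ => (1 : ℝ≥0∞)) (a, x)]
    refine tsum_congr fun x => ?_
    simp only [h a]
    by_cases h1 : x ∈ (g a).1 <;> by_cases h2 : (a, x) ∈ T <;> by_cases h3 : x ∈ Λ <;>
      simp [h1, h2, h3]
  rw [heq]
  exact measurable_tsum hg (measurable_const.indicator (hT.inter (measurable_snd hΛ)))

theorem measurable_restrict {Λ : Set (𝔼 d)} (hΛ : MeasurableSet Λ) :
    Measurable fun γ : Config d => γ.restrict Λ :=
  measurable_of_eq_sep measurable_id (T := Prod.snd ⁻¹' Λ) (measurable_snd hΛ) fun _ => rfl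

theorem measurable_restrict_closedBall (R : ℝ) :
    Measurable fun p : 𝔼 d × Config d => p.2.restrict (Metric.closedBall p.1 R) :=
  measurable_of_eq_sep measurable_snd (T := {q : (𝔼 d × Config d) × 𝔼 d | dist q.2 q.1.1 ≤ R})
    (measurableSet_le (by fun_prop) measurable_const) fun _ => rfl

theorem measurable_erase : Measurable fun p : 𝔼 d × Config d => p.2.erase p.1 :=
  measurable_of_eq_sep measurable_snd (T := {q : (𝔼 d × Config d) × 𝔼 d | q.2 = q.1.1}ᶜ)
    (measurableSet_eq_fun (by fun_prop) (by fun_prop)).compl fun _ => rfl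

theorem measurable_union : Measurable fun p : Config d × Config d => p.1.union p.2 := by
  refine measurable_of_tsum fun Λ hΛ _ => ?_
  have heq : (fun p : Config d × Config d =>
      ∑' x : (p.1.union p.2).1, Λ.indicator (fun _ => (1 : ℝ≥0∞)) x) =
      fun p => (∑' x : p.1.1, Λ.indicator (fun _ => (1 : ℝ≥0∞)) x) +
        ∑' x : p.2.1, ((Prod.snd ⁻¹' Λ) ∩ {q : (Config d × Config d) × 𝔼 d |
          q.2 ∈ q.1.1.1}ᶜ).indicator (fun _ => (1 : ℝ≥0∞)) (p, x) := by
    funext p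
    rw [tsum_subtype (p.1.union p.2).1 (Λ.indicator fun _ => (1 : ℝ≥0∞)),
      tsum_subtype p.1.1 (Λ.indicator fun _ => (1 : ℝ≥0∞)),
      tsum_subtype p.2.1 fun x => ((Prod.snd ⁻¹' Λ) ∩ {q : (Config d × Config d) × 𝔼 d |
          q.2 ∈ q.1.1.1}ᶜ).indicator (fun _ => (1 : ℝ≥0∞)) (p, x), ← ENNReal.tsum_add]
    refine tsum_congr fun x => ?_
    simp only [Config.union]
    by_cases h1 : x ∈ p.1.1 <;> by_cases h2 : x ∈ p.2.1 <;> by_cases h3 : x ∈ Λ <;>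
      simp [h1, h2, h3]
  rw [heq]
  refine (measurable_tsum measurable_fst (measurable_const.indicator (measurable_snd hΛ))).add
    (measurable_tsum measurable_snd (measurable_const.indicator
      ((measurable_snd hΛ).inter (MeasurableSet.compl ?_))))
  exact (measurable_snd.prodMk (measurable_fst.comp measurable_fst)) measurableSet_mem

theorem measurable_insert : Measurable fun p : 𝔼 d × Config d => Config.insert p.1 p.2 := by
  have h1 : Measurable fun p : 𝔼 d × Config d => (fun _ : Fin 1 => p.1) :=
    measurable_pi_lambda _ fun _ => measurable_fst
  have h2 := measurable_union.comp (((measurable_ofPoints 1).comp h1).prodMk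
    (measurable_snd : Measurable (Prod.snd : 𝔼 d × Config d → Config d)))
  have heq : (fun p : 𝔼 d × Config d => Config.insert p.1 p.2) =
      fun p => (ofPoints fun _ : Fin 1 => p.1).union p.2 := by
    funext p
    apply Subtype.ext
    simp [Config.insert, Config.union, Config.ofPoints]
  rw [heq]
  exact h2

theorem insert_erase {γ : Config d} {x : 𝔼 d} (hx : x ∈ γ.1) : Config.insert x (γ.erase x) = γ := by
  apply Subtype.ext
  ext y
  by_cases h : y = x <;> simp [Config.insert, Config.erase, Config.restrict, h, hx]

theorem notMem_erase (γ : Config d) (x : 𝔼 d) : x ∉ (γ.erase x).1 := fun h => h.2 rfl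

end Config

/-! ### Energies that are finite everywhere -/

theorem energyDiff_coe (a b : ℝ) : energyDiff (a : EReal) (b : EReal) = ((a - b : ℝ) : EReal) := by
  simp [energyDiff]

theorem Config.window_insert {d : ℕ} (γ : Config d) {W : Set (𝔼 d)} (hW : Bornology.IsBounded W)
    {x : 𝔼 d} (hx : x ∈ W) :
    (Config.insert x γ).window W hW = FinConfig.insert x (γ.window W hW) := by
  apply Subtype.ext
  apply Subtype.ext
  change ({x} ∪ γ.1) ∩ W = {x} ∪ (γ.1 ∩ W)
  rw [Set.union_inter_distrib_right, Set.singleton_inter_of_mem hx]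

namespace EnergyFunction

variable {d : ℕ} (H : EnergyFunction d)

/-- The energy of a finite configuration as a real number (meaningful when it is finite). -/
noncomputable def real (γ : FinConfig d) : ℝ := (H.toFun γ).toReal

theorem measurable_real : Measurable H.real := measurable_ereal_toReal.comp H.measurable

variable {H}

theorem coe_real (hfin : ∀ γ, H.toFun γ ≠ ⊤) (γ : FinConfig d) :
    ((H.real γ : ℝ) : EReal) = H.toFun γ :=
  EReal.coe_toReal (hfin γ) (H.ne_bot γ)

theorem localEnergyFin_eq_coe (hfin : ∀ γ, H.toFun γ ≠ ⊤) (Δ : Set (𝔼 d)) (γ : FinConfig d) :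
    H.localEnergyFin Δ γ = ((H.real γ - H.real (γ.restrict Δᶜ) : ℝ) : EReal) := by
  rw [localEnergyFin, ← coe_real hfin, ← coe_real hfin, energyDiff_coe]

/-- Finite range, for the energy of one added point: `h(x, γ) = h(x, γ_W)` for each
`W ⊇ B(x, R)`. -/
theorem pointEnergyFin_window {R : ℝ} (hR : 0 < R) (hr : H.HasFiniteRange R) {γ : Config d}
    {x : 𝔼 d} (hx : x ∉ γ.1) {W : Set (𝔼 d)} (hW : Bornology.IsBounded W)
    (hxW : Metric.closedBall x R ⊆ W) :
    H.pointEnergyFin x (γ.window W hW) = H.pointEnergy R x γ := by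
  have h := hr {x} Bornology.isBounded_singleton (FinConfig.insert x (γ.window W hW))
  have hball : ({x} : Set (𝔼 d)) + Metric.closedBall 0 R = Metric.closedBall x R := by
    rw [singleton_add_closedBall, add_zero]
  have hxx : x ∈ Metric.closedBall x R := Metric.mem_closedBall_self hR.le
  rw [hball] at h
  have e1 : (FinConfig.insert x (γ.window W hW)).restrict {x}ᶜ = γ.window W hW := by
    apply Subtype.ext
    apply Subtype.ext
    change ({x} ∪ (γ.1 ∩ W)) ∩ {x}ᶜ = γ.1 ∩ W
    ext y
    by_cases hy : y = x
    · subst hy; simp [hx]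
    · simp [hy]
  have e2 : (FinConfig.insert x (γ.window W hW)).restrict (Metric.closedBall x R) =
      FinConfig.insert x (γ.window (Metric.closedBall x R) Metric.isBounded_closedBall) := by
    apply Subtype.ext
    apply Subtype.ext
    change ({x} ∪ (γ.1 ∩ W)) ∩ Metric.closedBall x R = {x} ∪ (γ.1 ∩ Metric.closedBall x R)
    rw [Set.union_inter_distrib_right, Set.singleton_inter_of_mem hxx, Set.inter_assoc,
      Set.inter_eq_right.2 hxW]
  have e3 : (FinConfig.insert x (γ.window (Metric.closedBall x R)
      Metric.isBounded_closedBall)).restrict {x}ᶜ =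
      γ.window (Metric.closedBall x R) Metric.isBounded_closedBall := by
    apply Subtype.ext
    apply Subtype.ext
    change ({x} ∪ (γ.1 ∩ Metric.closedBall x R)) ∩ {x}ᶜ = γ.1 ∩ Metric.closedBall x R
    ext y
    by_cases hy : y = x
    · subst hy; simp [hx]
    · simp [hy]
  rw [localEnergyFin, localEnergyFin, e1, e2, e3] at h
  exact h

/-- If no added point costs infinite energy, then every finite configuration has finite energy. -/
theorem ne_top_of_pointEnergy_ne_top {R : ℝ} (hR : 0 < R) (hr : H.HasFiniteRange R)
    (hh : ∀ (γ : Config d) (x : 𝔼 d), x ∉ γ.1 → H.pointEnergy R x γ ≠ ⊤) (γ : FinConfig d) :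
    H.toFun γ ≠ ⊤ := by
  suffices h : ∀ s : Set (𝔼 d), s.Finite → ∀ (η : FinConfig d), η.1.1 = s → H.toFun η ≠ ⊤ from
    h γ.1.1 γ.2 γ rfl
  intro s hs
  induction s, hs using Set.Finite.induction_on with
  | empty =>
    intro η hη
    have : η = FinConfig.empty := Subtype.ext (Subtype.ext hη)
    rw [this]
    exact H.nondegenerate.ne
  | @insert x s hx hsfin ih =>
    intro η hη
    let γ : FinConfig d := ⟨⟨s, fun Λ _ => hsfin.inter_of_left Λ⟩, hsfin⟩
    have hγ : H.toFun γ ≠ ⊤ := ih γ rfl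
    have hW : Bornology.IsBounded (s ∪ Metric.closedBall x R) :=
      hsfin.isBounded.union Metric.isBounded_closedBall
    have h1 := hh γ.1 x hx
    have e : γ.1.window _ hW = γ := by
      apply Subtype.ext
      apply Subtype.ext
      exact Set.inter_eq_left.2 subset_union_left
    have e' : FinConfig.insert x γ = η := by
      apply Subtype.ext
      apply Subtype.ext
      rw [hη, ← Set.singleton_union]
      rfl
    rw [← pointEnergyFin_window hR hr hx hW subset_union_right, e, pointEnergyFin, energyDiff,
      if_neg (fun h => hγ h.2), e'] at h1
    intro htop
    apply h1
    rw [htop, ← EReal.coe_toReal hγ (H.ne_bot γ)]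
    exact EReal.top_sub_coe _

theorem toReal_pointEnergy (hfin : ∀ γ, H.toFun γ ≠ ⊤) {R : ℝ} (hR : 0 < R)
    (hr : H.HasFiniteRange R) {γ : Config d}
    {x : 𝔼 d} (hx : x ∉ γ.1) {W : Set (𝔼 d)} (hW : Bornology.IsBounded W)
    (hxW : Metric.closedBall x R ⊆ W) :
    (H.pointEnergy R x γ).toReal =
      H.real (FinConfig.insert x (γ.window W hW)) - H.real (γ.window W hW) := by
  rw [← pointEnergyFin_window hR hr hx hW hxW, pointEnergyFin, ← coe_real hfin, ← coe_real hfin,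
    energyDiff_coe, EReal.toReal_coe]

/-- The local energy splits off one point `x ∈ Δ` through `h(x, γ)`. -/
theorem localEnergy_insert (hfin : ∀ γ, H.toFun γ ≠ ⊤) {R : ℝ} (hR : 0 < R)
    (hr : H.HasFiniteRange R) {Δ : Set (𝔼 d)} (hΔ : Bornology.IsBounded Δ) {γ : Config d}
    {x : 𝔼 d} (hxΔ : x ∈ Δ) (hx : x ∉ γ.1) :
    (H.localEnergy R Δ hΔ (Config.insert x γ)).toReal =
      (H.pointEnergy R x γ).toReal + (H.localEnergy R Δ hΔ γ).toReal := by
  set W := Δ + Metric.closedBall 0 R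
  have hW : Bornology.IsBounded W := hΔ.add Metric.isBounded_closedBall
  have hball : Metric.closedBall x R ⊆ W := by
    have h : ({x} : Set (𝔼 d)) + Metric.closedBall 0 R = Metric.closedBall x R := by
      rw [singleton_add_closedBall, add_zero]
    rw [← h]
    exact Set.add_subset_add_right (Set.singleton_subset_iff.2 hxΔ)
  have hxW : x ∈ W := hball (Metric.mem_closedBall_self hR.le)
  have e : (FinConfig.insert x (γ.window W hW)).restrict Δᶜ = (γ.window W hW).restrict Δᶜ := by
    apply Subtype.ext
    apply Subtype.ext
    change ({x} ∪ (γ.1 ∩ W)) ∩ Δᶜ = (γ.1 ∩ W) ∩ Δᶜ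
    ext y
    by_cases hy : y = x
    · subst hy; simp [hxΔ]
    · simp [hy]
  rw [toReal_pointEnergy hfin hR hr hx hW hball, localEnergy, localEnergy,
    Config.window_insert γ hW hxW, localEnergyFin_eq_coe hfin, localEnergyFin_eq_coe hfin, e,
    EReal.toReal_coe, EReal.toReal_coe]
  ring

theorem localEnergy_eq_coe (hfin : ∀ γ, H.toFun γ ≠ ⊤) (R : ℝ) {Δ : Set (𝔼 d)}
    (hΔ : Bornology.IsBounded Δ) (γ : Config d) :
    H.localEnergy R Δ hΔ γ = (((H.localEnergy R Δ hΔ γ).toReal : ℝ) : EReal) := by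
  rw [localEnergy, localEnergyFin_eq_coe hfin, EReal.toReal_coe]

/-- Symmetry of the energy cost of two added points. -/
theorem pointEnergy_add_comm (hfin : ∀ γ, H.toFun γ ≠ ⊤) {R : ℝ} (hR : 0 < R)
    (hr : H.HasFiniteRange R) {η : Config d} {x y : 𝔼 d} (hxy : x ≠ y) (hx : x ∉ η.1)
    (hy : y ∉ η.1) :
    (H.pointEnergy R y (Config.insert x η)).toReal + (H.pointEnergy R x η).toReal =
      (H.pointEnergy R x (Config.insert y η)).toReal + (H.pointEnergy R y η).toReal := by
  have hW : Bornology.IsBounded (Metric.closedBall x R ∪ Metric.closedBall y R) :=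
    Metric.isBounded_closedBall.union Metric.isBounded_closedBall
  have hxW : Metric.closedBall x R ⊆ Metric.closedBall x R ∪ Metric.closedBall y R :=
    subset_union_left
  have hyW : Metric.closedBall y R ⊆ Metric.closedBall x R ∪ Metric.closedBall y R :=
    subset_union_right
  have hx' : x ∉ (Config.insert y η).1 := by
    rintro (h | h)
    exacts [hxy h, hx h]
  have hy' : y ∉ (Config.insert x η).1 := by
    rintro (h | h)
    exacts [hxy h.symm, hy h]
  rw [toReal_pointEnergy hfin hR hr hx hW hxW, toReal_pointEnergy hfin hR hr hy hW hyW,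
    toReal_pointEnergy hfin hR hr hx' hW hxW, toReal_pointEnergy hfin hR hr hy' hW hyW,
    Config.window_insert η hW (hxW (Metric.mem_closedBall_self hR.le)),
    Config.window_insert η hW (hyW (Metric.mem_closedBall_self hR.le))]
  have e : FinConfig.insert y (FinConfig.insert x (η.window _ hW)) =
      FinConfig.insert x (FinConfig.insert y (η.window _ hW)) := by
    apply Subtype.ext
    apply Subtype.ext
    exact Set.union_left_comm _ _ _
  rw [e]
  ring

/-- By stability, the energy cost of one added point is locally bounded below. -/
theorem exists_le_pointEnergy (hfin : ∀ γ, H.toFun γ ≠ ⊤) {R : ℝ} (hR : 0 < R)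
    (hr : H.HasFiniteRange R) (γ : Config d) (s : 𝔼 d) :
    ∃ C : ℝ, ∀ x ∈ Metric.closedBall s 1, x ∉ γ.1 → C ≤ (H.pointEnergy R x γ).toReal := by
  obtain ⟨A, hA⟩ := H.stable
  have hW : Bornology.IsBounded (Metric.closedBall s (R + 1)) := Metric.isBounded_closedBall
  refine ⟨-(|A| * ((γ.window _ hW).card + 1)) - H.real (γ.window _ hW), fun x hx hxγ => ?_⟩
  have hxW : Metric.closedBall x R ⊆ Metric.closedBall s (R + 1) :=
    Metric.closedBall_subset_closedBall' (by have := Metric.mem_closedBall.1 hx; linarith)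
  rw [toReal_pointEnergy hfin hR hr hxγ hW hxW]
  have h1 := hA (FinConfig.insert x (γ.window _ hW))
  rw [← coe_real hfin, EReal.coe_le_coe_iff] at h1
  have h2 : ((FinConfig.insert x (γ.window _ hW)).card : ℝ) ≤ (γ.window _ hW).card + 1 := by
    have : (FinConfig.insert x (γ.window _ hW)).card ≤ 1 + (γ.window _ hW).card := by
      refine (Set.ncard_union_le _ _).trans ?_
      rw [Set.ncard_singleton]
      rfl
    have h3 : ((FinConfig.insert x (γ.window _ hW)).card : ℝ) ≤
      ((1 + (γ.window _ hW).card : ℕ) : ℝ) := by exact_mod_cast this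
    push_cast at h3
    linarith
  have h4 : -(|A| * ((γ.window _ hW).card + 1)) ≤
      A * (FinConfig.insert x (γ.window _ hW)).card := by
    have h5 : |A| * ((FinConfig.insert x (γ.window _ hW)).card : ℝ) ≤
        |A| * ((γ.window _ hW).card + 1) := mul_le_mul_of_nonneg_left h2 (abs_nonneg A)
    have h6 : -(|A| * ((FinConfig.insert x (γ.window _ hW)).card : ℝ)) ≤
        A * (FinConfig.insert x (γ.window _ hW)).card := by
      rw [← neg_mul]
      exact mul_le_mul_of_nonneg_right (neg_abs_le A) (Nat.cast_nonneg _)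
    linarith
  linarith

theorem measurable_pointEnergy (hfin : ∀ γ, H.toFun γ ≠ ⊤) (R : ℝ) :
    Measurable fun p : 𝔼 d × Config d => (H.pointEnergy R p.1 p.2).toReal := by
  have hw : Measurable fun p : 𝔼 d × Config d =>
      p.2.window (Metric.closedBall p.1 R) Metric.isBounded_closedBall :=
    (Config.measurable_restrict_closedBall R).subtype_mk
  have hi : Measurable fun p : 𝔼 d × Config d => FinConfig.insert p.1
      (p.2.window (Metric.closedBall p.1 R) Metric.isBounded_closedBall) :=
    (Config.measurable_insert.comp
      (measurable_fst.prodMk (Config.measurable_restrict_closedBall R))).subtype_mk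
  have heq : (fun p : 𝔼 d × Config d => (H.pointEnergy R p.1 p.2).toReal) = fun p =>
      H.real (FinConfig.insert p.1
        (p.2.window (Metric.closedBall p.1 R) Metric.isBounded_closedBall)) -
      H.real (p.2.window (Metric.closedBall p.1 R) Metric.isBounded_closedBall) := by
    funext p
    rw [pointEnergy, pointEnergyFin, ← coe_real hfin, ← coe_real hfin, energyDiff_coe,
      EReal.toReal_coe]
  rw [heq]
  exact (H.measurable_real.comp hi).sub (H.measurable_real.comp hw)

theorem measurable_localEnergy (hfin : ∀ γ, H.toFun γ ≠ ⊤) (R : ℝ) {Δ : Set (𝔼 d)}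
    (hΔ : Bornology.IsBounded Δ) (hΔm : MeasurableSet Δ)
    (hΔR : MeasurableSet (Δ + Metric.closedBall 0 R)) :
    Measurable fun γ : Config d => (H.localEnergy R Δ hΔ γ).toReal := by
  have hw : Measurable fun γ : Config d =>
      γ.window (Δ + Metric.closedBall 0 R) (hΔ.add Metric.isBounded_closedBall) :=
    (Config.measurable_restrict hΔR).subtype_mk
  have hc : Measurable fun γ : Config d =>
      (γ.window (Δ + Metric.closedBall 0 R) (hΔ.add Metric.isBounded_closedBall)).restrict Δᶜ :=
    ((Config.measurable_restrict hΔm.compl).comp (Config.measurable_restrict hΔR)).subtype_mk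
  have heq : (fun γ : Config d => (H.localEnergy R Δ hΔ γ).toReal) = fun γ =>
      H.real (γ.window (Δ + Metric.closedBall 0 R) (hΔ.add Metric.isBounded_closedBall)) -
      H.real ((γ.window (Δ + Metric.closedBall 0 R)
        (hΔ.add Metric.isBounded_closedBall)).restrict Δᶜ) := by
    funext γ
    rw [localEnergy, localEnergyFin_eq_coe hfin, EReal.toReal_coe]
  rw [heq]
  exact (H.measurable_real.comp hw).sub (H.measurable_real.comp hc)

end EnergyFunction

/-! ### The Mecke formula for the Poisson point process -/

section GNZ

variable {d : ℕ}

instance (Δ : Set (𝔼 d)) : SFinite (poissonLaw Δ) := by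
  unfold poissonLaw
  infer_instance

theorem Config.measurable_tsum_erase {F : 𝔼 d × Config d → ℝ≥0∞} (hF : Measurable F) :
    Measurable fun γ : Config d => ∑' x : γ.1, F (x, γ.erase x) := by
  have h : Measurable fun p : Config d × 𝔼 d => F (p.2, p.1.erase p.2) :=
    hF.comp (measurable_snd.prodMk (Config.measurable_erase.comp measurable_swap))
  exact Config.measurable_tsum measurable_id h

theorem ae_pi_injective [NullSingletonClass (volume : Measure (𝔼 d))] (Δ : Set (𝔼 d)) (n : ℕ) :
    ∀ᵐ x ∂(Measure.pi fun _ : Fin n => (volume : Measure (𝔼 d)).restrict Δ),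
      Function.Injective x := by
  cases n with
  | zero => exact Eventually.of_forall fun x i => i.elim0
  | succ n =>
    have h : ∀ (i : Fin (n + 1)) (k : Fin n),
        ∀ᵐ x ∂(Measure.pi fun _ : Fin (n + 1) => (volume : Measure (𝔼 d)).restrict Δ),
          x i ≠ x (i.succAbove k) := by
      intro i k
      have hmp := measurePreserving_piFinSuccAbove
        (fun _ : Fin (n + 1) => (volume : Measure (𝔼 d)).restrict Δ) i
      have hms : MeasurableSet {p : 𝔼 d × (Fin n → 𝔼 d) | p.1 = p.2 k} :=
        measurableSet_eq_fun measurable_fst ((measurable_pi_apply k).comp measurable_snd)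
      have hae : ∀ᵐ p ∂(((volume : Measure (𝔼 d)).restrict Δ).prod
          (Measure.pi fun _ : Fin n => (volume : Measure (𝔼 d)).restrict Δ)), p.1 ≠ p.2 k := by
        rw [ae_iff]
        have hc : {p : 𝔼 d × (Fin n → 𝔼 d) | ¬p.1 ≠ p.2 k} = {p | p.1 = p.2 k} := by
          ext; simp
        rw [hc, Measure.prod_apply_symm hms, lintegral_eq_zero_iff
          (measurable_measure_prodMk_right hms)]
        refine Eventually.of_forall fun w => ?_
        have : (fun x => (x, w)) ⁻¹' {p : 𝔼 d × (Fin n → 𝔼 d) | p.1 = p.2 k} = {w k} := by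
          ext; simp
        change (volume.restrict Δ) ((fun x => (x, w)) ⁻¹' {p | p.1 = p.2 k}) = 0
        rw [this]
        exact measure_singleton _
      exact hmp.quasiMeasurePreserving.ae hae
    have h' := ae_all_iff.2 fun i => ae_all_iff.2 (h i)
    filter_upwards [h'] with x hx i j hij
    by_contra hne
    obtain ⟨k, hk⟩ := Fin.exists_succAbove_eq (Ne.symm hne)
    exact hx i k (hk ▸ hij)

theorem tsum_erase_ofPoints {n : ℕ} {x : Fin (n + 1) → 𝔼 d} (hx : Function.Injective x)
    (M : 𝔼 d × Config d → ℝ≥0∞) :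
    ∑' y : (Config.ofPoints x).1, M (y, (Config.ofPoints x).erase y) =
      ∑ i, M (x i, Config.ofPoints fun j => x (i.succAbove j)) := by
  have h1 : ∑' y : (Config.ofPoints x).1, M (y, (Config.ofPoints x).erase y) =
      ∑' i, M (x i, (Config.ofPoints x).erase (x i)) :=
    tsum_range (fun y => M (y, (Config.ofPoints x).erase y)) hx
  rw [h1, tsum_fintype]
  refine Finset.sum_congr rfl fun i _ => ?_
  have h2 : (Config.ofPoints x).erase (x i) = Config.ofPoints fun j => x (i.succAbove j) := by
    apply Subtype.ext
    change range x ∩ {x i}ᶜ = range fun j => x (i.succAbove j)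
    ext y
    constructor
    · rintro ⟨⟨j, rfl⟩, hj⟩
      obtain ⟨k, hk⟩ := Fin.exists_succAbove_eq (x := j) (y := i) (fun h => hj (by rw [h]; rfl))
      exact ⟨k, congrArg x hk⟩
    · rintro ⟨k, rfl⟩
      exact ⟨⟨_, rfl⟩, fun h => Fin.succAbove_ne i k (hx h)⟩
  rw [h2]

theorem lintegral_poissonLaw (Δ : Set (𝔼 d)) {G : Config d → ℝ≥0∞} (hG : Measurable G) :
    ∫⁻ γ, G γ ∂(poissonLaw Δ) =
      ∑' n : ℕ, ENNReal.ofReal (Real.exp (-(volume Δ).toReal) / (n ! : ℝ)) *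
        ∫⁻ x, G (Config.ofPoints x)
          ∂(Measure.pi fun _ : Fin n => (volume : Measure (𝔼 d)).restrict Δ) := by
  rw [poissonLaw, lintegral_sum_measure]
  refine tsum_congr fun n => ?_
  rw [lintegral_smul_measure, lintegral_map hG (Config.measurable_ofPoints n), smul_eq_mul]

/-- The Mecke formula: removing a point of a Poisson process amounts to integrating over an
independent added point. -/
theorem lintegral_tsum_poissonLaw [NullSingletonClass (volume : Measure (𝔼 d))] (Δ : Set (𝔼 d))
    {M : 𝔼 d × Config d → ℝ≥0∞} (hM : Measurable M) :
    ∫⁻ γ, ∑' x : γ.1, M (x, γ.erase x) ∂(poissonLaw Δ) =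
      ∫⁻ γ, (∫⁻ x in Δ, M (x, γ)) ∂(poissonLaw Δ) := by
  have hM2 : Measurable fun γ : Config d => ∫⁻ x in Δ, M (x, γ) := hM.lintegral_prod_left'
  rw [lintegral_poissonLaw Δ (Config.measurable_tsum_erase hM), lintegral_poissonLaw Δ hM2,
    tsum_eq_zero_add' ENNReal.summable]
  have h0 : ∀ x : Fin 0 → 𝔼 d,
      ∑' y : (Config.ofPoints x).1, M (y, (Config.ofPoints x).erase y) = 0 := by
    intro x
    have : IsEmpty (Config.ofPoints x).1 := ⟨fun ⟨_, i, _⟩ => i.elim0⟩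
    exact tsum_empty
  simp_rw [h0]
  rw [lintegral_zero, mul_zero, zero_add]
  refine tsum_congr fun n => ?_
  set μ := (volume : Measure (𝔼 d)).restrict Δ
  have hi : ∀ i : Fin (n + 1),
      ∫⁻ x, M (x i, Config.ofPoints fun j => x (i.succAbove j))
        ∂(Measure.pi fun _ : Fin (n + 1) => μ) =
      ∫⁻ w, ∫⁻ y, M (y, Config.ofPoints w) ∂μ ∂(Measure.pi fun _ : Fin n => μ) := by
    intro i
    have hmp := measurePreserving_piFinSuccAbove (fun _ : Fin (n + 1) => μ) i
    have hm : Measurable fun p : 𝔼 d × (Fin n → 𝔼 d) => M (p.1, Config.ofPoints p.2) :=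
      hM.comp (measurable_fst.prodMk ((Config.measurable_ofPoints n).comp measurable_snd))
    rw [← lintegral_prod_symm' _ hm, ← hmp.lintegral_comp hm]
    rfl
  have hsum : ∫⁻ x, ∑' y : (Config.ofPoints x).1, M (y, (Config.ofPoints x).erase y)
        ∂(Measure.pi fun _ : Fin (n + 1) => μ) =
      ((n : ℝ≥0∞) + 1) *
        ∫⁻ w, ∫⁻ y, M (y, Config.ofPoints w) ∂μ ∂(Measure.pi fun _ : Fin n => μ) := by
    have hae : ∀ᵐ x ∂(Measure.pi fun _ : Fin (n + 1) => μ),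
        ∑' y : (Config.ofPoints x).1, M (y, (Config.ofPoints x).erase y) =
          ∑ i, M (x i, Config.ofPoints fun j => x (i.succAbove j)) := by
      filter_upwards [ae_pi_injective Δ (n + 1)] with x hx using tsum_erase_ofPoints hx M
    rw [lintegral_congr_ae hae, lintegral_finsetSum]
    · simp only [hi, Finset.sum_const, Finset.card_univ, Fintype.card_fin, nsmul_eq_mul,
        Nat.cast_add, Nat.cast_one]
    · intro i _
      exact hM.comp ((measurable_pi_apply i).prodMk ((Config.measurable_ofPoints n).comp
        (measurable_pi_lambda _ fun j => measurable_pi_apply (i.succAbove j))))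
  rw [hsum, ← mul_assoc]
  congr 1
  have hcast : ((n : ℝ≥0∞) + 1) = ENNReal.ofReal ((n : ℝ) + 1) := by
    rw [ENNReal.ofReal_add (Nat.cast_nonneg n) zero_le_one, ENNReal.ofReal_natCast,
      ENNReal.ofReal_one]
  rw [hcast, ← ENNReal.ofReal_mul (by positivity), Nat.factorial_succ]
  congr 1
  push_cast
  field_simp

/-! ### The Georgii–Nguyen–Zessin equation -/

variable {H : EnergyFunction d} {R z β : ℝ}

theorem gibbsWeight_eq (hfin : ∀ γ, H.toFun γ ≠ ⊤) {Δ : Set (𝔼 d)} (hΔ : Bornology.IsBounded Δ)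
    (γ γ' : Config d) :
    gibbsWeight H R z β Δ hΔ γ γ' = ENNReal.ofReal z ^ γ'.count Δ *
      ENNReal.ofReal (Real.exp (-(β *
        (H.localEnergy R Δ hΔ ((γ'.restrict Δ).union (γ.restrict Δᶜ))).toReal))) := by
  rw [gibbsWeight, EnergyFunction.localEnergy_eq_coe hfin, EReal.toReal_coe, ← EReal.coe_mul,
    ← EReal.coe_neg, EReal.exp_coe]

theorem measurable_gibbsWeight (hfin : ∀ γ, H.toFun γ ≠ ⊤) {Δ : Set (𝔼 d)}
    (hΔ : Bornology.IsBounded Δ) (hΔm : MeasurableSet Δ)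
    (hΔR : MeasurableSet (Δ + Metric.closedBall 0 R)) :
    Measurable fun p : Config d × Config d => gibbsWeight H R z β Δ hΔ p.1 p.2 := by
  simp_rw [gibbsWeight_eq hfin]
  have h1 : Measurable fun p : Config d × Config d => p.2.count Δ :=
    (Config.measurable_count hΔm hΔ).comp measurable_snd
  have h2 : Measurable fun p : Config d × Config d =>
      (p.2.restrict Δ).union (p.1.restrict Δᶜ) :=
    Config.measurable_union.comp (((Config.measurable_restrict hΔm).comp measurable_snd).prodMk
      ((Config.measurable_restrict hΔm.compl).comp measurable_fst))
  have h3 : Measurable fun p : Config d × Config d => ENNReal.ofReal z ^ p.2.count Δ :=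
    (measurable_from_top (f := fun n : ℕ => ENNReal.ofReal z ^ n)).comp h1
  refine h3.mul ?_
  exact ((((EnergyFunction.measurable_localEnergy hfin R hΔ hΔm hΔR).comp h2).const_mul
    β).neg.exp).ennreal_ofReal

/-- The density of the Gibbs kernel acquires the factor `z exp(-β h(x, ·))` when a point `x` is
added in `Δ`. -/
theorem gibbsWeight_insert (hfin : ∀ γ, H.toFun γ ≠ ⊤) (hR : 0 < R) (hr : H.HasFiniteRange R)
    (hz : 0 < z) {Δ : Set (𝔼 d)} (hΔ : Bornology.IsBounded Δ) {γ γ' : Config d} {x : 𝔼 d}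
    (hxΔ : x ∈ Δ) (hx' : x ∉ γ'.1) :
    gibbsWeight H R z β Δ hΔ γ (Config.insert x γ') =
      gibbsWeight H R z β Δ hΔ γ γ' * ENNReal.ofReal (z * Real.exp (-(β *
        (H.pointEnergy R x ((γ'.restrict Δ).union (γ.restrict Δᶜ))).toReal))) := by
  have hc : (Config.insert x γ').count Δ = γ'.count Δ + 1 := by
    have : ({x} ∪ γ'.1) ∩ Δ = Insert.insert x (γ'.1 ∩ Δ) := by
      rw [Set.union_inter_distrib_right, Set.singleton_inter_of_mem hxΔ, Set.singleton_union]
    change (({x} ∪ γ'.1) ∩ Δ).ncard = (γ'.1 ∩ Δ).ncard + 1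
    rw [this, Set.ncard_insert_of_notMem (fun h => hx' h.1) (γ'.2 Δ hΔ)]
  have hu : ((Config.insert x γ').restrict Δ).union (γ.restrict Δᶜ) =
      Config.insert x ((γ'.restrict Δ).union (γ.restrict Δᶜ)) := by
    apply Subtype.ext
    change (({x} ∪ γ'.1) ∩ Δ) ∪ (γ.1 ∩ Δᶜ) = {x} ∪ ((γ'.1 ∩ Δ) ∪ (γ.1 ∩ Δᶜ))
    rw [Set.union_inter_distrib_right, Set.singleton_inter_of_mem hxΔ, Set.union_assoc]
  have hxu : x ∉ ((γ'.restrict Δ).union (γ.restrict Δᶜ)).1 := by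
    rintro (h | h)
    exacts [hx' h.1, h.2 hxΔ]
  rw [gibbsWeight_eq hfin, gibbsWeight_eq hfin, hc, hu,
    EnergyFunction.localEnergy_insert hfin hR hr hΔ hxΔ hxu, mul_add, neg_add, Real.exp_add,
    ENNReal.ofReal_mul (Real.exp_pos _).le, ENNReal.ofReal_mul hz.le, pow_succ]
  ring

/-- If the conditional law of `r₁` given `r₂` has the density `c(a) w(a, ·)` with respect to `π`, in
the sense of measurable rectangles, then the disintegration formula holds for all functions of
`(r₁, r₂)`. -/
theorem lintegral_prodMk_of_kernel {α β γ : Type*} [MeasurableSpace α] [MeasurableSpace β]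
    [MeasurableSpace γ] {P : Measure α} [IsProbabilityMeasure P] {π : Measure β} [SFinite π]
    {r₁ : α → β} {r₂ : α → γ} (hr₁ : Measurable r₁) (hr₂ : Measurable r₂)
    {w : α × β → ℝ≥0∞} (hw : Measurable w) {c : α → ℝ≥0∞} (hc : Measurable c)
    (h : ∀ A B, MeasurableSet A → MeasurableSet B →
      P {a | r₁ a ∈ A ∧ r₂ a ∈ B} = ∫⁻ a in {a | r₂ a ∈ B}, c a * ∫⁻ b in A, w (a, b) ∂π ∂P)
    {Φ : β × γ → ℝ≥0∞} (hΦ : Measurable Φ) :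
    ∫⁻ a, Φ (r₁ a, r₂ a) ∂P = ∫⁻ a, c a * ∫⁻ b, w (a, b) * Φ (b, r₂ a) ∂π ∂P := by
  have hm1 : Measurable fun a => (r₁ a, r₂ a) := hr₁.prodMk hr₂
  have hm2 : Measurable fun p : α × β => (p.2, r₂ p.1) :=
    measurable_snd.prodMk (hr₂.comp measurable_fst)
  have hρ : Measurable fun p : α × β => c p.1 * w p := (hc.comp measurable_fst).mul hw
  have hΦ' : Measurable fun p : α × β => Φ (p.2, r₂ p.1) := hΦ.comp hm2
  have hkey : P.map (fun a => (r₁ a, r₂ a)) =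
      ((P.prod π).withDensity fun p => c p.1 * w p).map fun p => (p.2, r₂ p.1) := by
    have : IsProbabilityMeasure (P.map (fun a => (r₁ a, r₂ a))) :=
      Measure.isProbabilityMeasure_map hm1.aemeasurable
    refine Measure.ext_prod fun {A B} hA hB => ?_
    have e2 : (fun p : α × β => (p.2, r₂ p.1)) ⁻¹' (A ×ˢ B) = {a | r₂ a ∈ B} ×ˢ A := by
      ext p
      exact and_comm
    rw [Measure.map_apply hm1 (hA.prod hB), Measure.map_apply hm2 (hA.prod hB),
      withDensity_apply _ (hm2 (hA.prod hB)), e2, ← Measure.prod_restrict,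
      lintegral_prod _ hρ.aemeasurable]
    refine (h A B hA hB).trans (lintegral_congr fun a => ?_)
    exact (lintegral_const_mul _ (hw.comp measurable_prodMk_left)).symm
  rw [← lintegral_map hΦ hm1, hkey, lintegral_map hΦ hm2,
    lintegral_withDensity_eq_lintegral_mul _ hρ hΦ', lintegral_prod _ (hρ.mul hΦ').aemeasurable]
  refine lintegral_congr fun a => ?_
  have hm3 : Measurable fun b => w (a, b) * Φ (b, r₂ a) :=
    (hw.comp measurable_prodMk_left).mul (hΦ'.comp measurable_prodMk_left)
  rw [← lintegral_const_mul _ hm3]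
  refine lintegral_congr fun b => ?_
  simp only [Pi.mul_apply]
  ring

/-- The DLR equations for functions of the pair `(γ_Δ, γ_{Δᶜ})`. -/
theorem IsGibbsMeasure.lintegral_restrict (hfin : ∀ γ, H.toFun γ ≠ ⊤) {P : Measure (Config d)}
    (hP : IsGibbsMeasure H R z β P) {Δ : Set (𝔼 d)} (hΔ : Bornology.IsBounded Δ)
    (hΔm : MeasurableSet Δ) (hΔR : MeasurableSet (Δ + Metric.closedBall 0 R))
    (hΔv : 0 < volume Δ) {Φ : Config d × Config d → ℝ≥0∞} (hΦ : Measurable Φ) :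
    ∫⁻ γ, Φ (γ.restrict Δ, γ.restrict Δᶜ) ∂P =
      ∫⁻ γ, (partitionFunction H R z β Δ hΔ γ)⁻¹ *
        ∫⁻ γ', gibbsWeight H R z β Δ hΔ γ γ' * Φ (γ', γ.restrict Δᶜ) ∂(poissonLaw Δ) ∂P := by
  have := hP.isProbabilityMeasure
  have hW := measurable_gibbsWeight (z := z) (β := β) hfin hΔ hΔm hΔR
  exact lintegral_prodMk_of_kernel (Config.measurable_restrict hΔm)
    (Config.measurable_restrict hΔm.compl) hW (hW.lintegral_prod_right').inv
    (fun A B hA hB => hP.dlr Δ hΔ hΔm hΔv A B hA hB) hΦ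

theorem Config.restrict_union_restrict_compl (γ : Config d) (Δ : Set (𝔼 d)) :
    (γ.restrict Δ).union (γ.restrict Δᶜ) = γ :=
  Subtype.ext (Set.inter_union_compl γ.1 Δ)

/-- The density `z exp(-β h(x, γ))` of the Georgii–Nguyen–Zessin equation. -/
noncomputable def papangelou (H : EnergyFunction d) (R z β : ℝ) (p : 𝔼 d × Config d) : ℝ≥0∞ :=
  ENNReal.ofReal (z * Real.exp (-(β * (H.pointEnergy R p.1 p.2).toReal)))

theorem measurable_papangelou (hfin : ∀ γ, H.toFun γ ≠ ⊤) :
    Measurable (papangelou H R z β) :=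
  (((EnergyFunction.measurable_pointEnergy hfin R).const_mul β).neg.exp.const_mul
    z).ennreal_ofReal

/-- The Georgii–Nguyen–Zessin equation for points in a bounded window. -/
theorem IsGibbsMeasure.lintegral_tsum_window [NullSingletonClass (volume : Measure (𝔼 d))]
    (hfin : ∀ γ, H.toFun γ ≠ ⊤) (hR : 0 < R) (hr : H.HasFiniteRange R) (hz : 0 < z)
    {P : Measure (Config d)} (hP : IsGibbsMeasure H R z β P) {Δ : Set (𝔼 d)}
    (hΔ : Bornology.IsBounded Δ) (hΔm : MeasurableSet Δ)
    (hΔR : MeasurableSet (Δ + Metric.closedBall 0 R)) (hΔv : 0 < volume Δ)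
    {F : 𝔼 d × Config d → ℝ≥0∞} (hF : Measurable F) :
    ∫⁻ γ, ∑' x : γ.1, Δ.indicator (fun _ => F (x, γ.erase x)) (x : 𝔼 d) ∂P =
      ∫⁻ γ, (∫⁻ x in Δ, papangelou H R z β (x, γ) * F (x, γ)) ∂P := by
  have hr1 := Config.measurable_restrict hΔm
  have hr2 := Config.measurable_restrict hΔm.compl
  have hw := measurable_papangelou (R := R) (z := z) (β := β) hfin
  have hW := measurable_gibbsWeight (z := z) (β := β) hfin hΔ hΔm hΔR
  -- The two functions of `(γ_Δ, γ_{Δᶜ})` whose expectations are compared.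
  set Φ₁ : Config d × Config d → ℝ≥0∞ := fun p =>
    ∑' x : p.1.1, F (x, (p.1.erase x).union p.2)
  set Φ₂ : Config d × Config d → ℝ≥0∞ := fun p =>
    ∫⁻ x in Δ, papangelou H R z β (x, (p.1.restrict Δ).union p.2) * F (x, p.1.union p.2)
  have hΦ₁ : Measurable Φ₁ := by
    have h : Measurable fun q : (Config d × Config d) × 𝔼 d =>
        F (q.2, (q.1.1.erase q.2).union q.1.2) :=
      hF.comp (measurable_snd.prodMk (Config.measurable_union.comp
        ((Config.measurable_erase.comp (measurable_snd.prodMk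
          (measurable_fst.comp measurable_fst))).prodMk (measurable_snd.comp measurable_fst))))
    exact Config.measurable_tsum measurable_fst h
  have hΦ₂ : Measurable Φ₂ := by
    have h : Measurable fun q : (Config d × Config d) × 𝔼 d =>
        papangelou H R z β (q.2, (q.1.1.restrict Δ).union q.1.2) *
          F (q.2, q.1.1.union q.1.2) :=
      (hw.comp (measurable_snd.prodMk (Config.measurable_union.comp
        ((hr1.comp (measurable_fst.comp measurable_fst)).prodMk
          (measurable_snd.comp measurable_fst))))).mul
      (hF.comp (measurable_snd.prodMk (Config.measurable_union.comp measurable_fst)))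
    exact h.lintegral_prod_right'
  have e1 : ∀ γ : Config d, ∑' x : γ.1, Δ.indicator (fun _ => F (x, γ.erase x)) (x : 𝔼 d) =
      Φ₁ (γ.restrict Δ, γ.restrict Δᶜ) := by
    intro γ
    change _ = ∑' x : (γ.restrict Δ).1, F (x, ((γ.restrict Δ).erase x).union (γ.restrict Δᶜ))
    rw [tsum_subtype γ.1 fun x => Δ.indicator (fun _ => F (x, γ.erase x)) x,
      tsum_subtype (γ.restrict Δ).1 fun x =>
        F (x, ((γ.restrict Δ).erase x).union (γ.restrict Δᶜ))]
    refine tsum_congr fun x => ?_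
    by_cases h1 : x ∈ γ.1 <;> by_cases h2 : x ∈ Δ
    · have h3 : ((γ.restrict Δ).erase x).union (γ.restrict Δᶜ) = γ.erase x := by
        apply Subtype.ext
        change (γ.1 ∩ Δ ∩ {x}ᶜ) ∪ (γ.1 ∩ Δᶜ) = γ.1 ∩ {x}ᶜ
        ext y
        by_cases hy : y = x
        · subst hy; simp [h2]
        · by_cases hyΔ : y ∈ Δ <;> simp [hy, hyΔ]
      rw [indicator_of_mem h1, indicator_of_mem h2,
        indicator_of_mem (show x ∈ (γ.restrict Δ).1 from ⟨h1, h2⟩), h3]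
    · rw [indicator_of_mem h1, indicator_of_notMem h2,
        indicator_of_notMem (show x ∉ (γ.restrict Δ).1 from fun h => h2 h.2)]
    · rw [indicator_of_notMem h1,
        indicator_of_notMem (show x ∉ (γ.restrict Δ).1 from fun h => h1 h.1)]
    · rw [indicator_of_notMem h1,
        indicator_of_notMem (show x ∉ (γ.restrict Δ).1 from fun h => h1 h.1)]
  have e2 : ∀ γ : Config d, ∫⁻ x in Δ, papangelou H R z β (x, γ) * F (x, γ) =
      Φ₂ (γ.restrict Δ, γ.restrict Δᶜ) := by
    intro γ
    have h1 : (γ.restrict Δ).restrict Δ = γ.restrict Δ :=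
      Subtype.ext (by change γ.1 ∩ Δ ∩ Δ = γ.1 ∩ Δ; rw [Set.inter_assoc, Set.inter_self])
    change _ = ∫⁻ x in Δ, papangelou H R z β (x, ((γ.restrict Δ).restrict Δ).union
      (γ.restrict Δᶜ)) * F (x, (γ.restrict Δ).union (γ.restrict Δᶜ))
    rw [h1, Config.restrict_union_restrict_compl]
  simp_rw [e1, e2]
  rw [hP.lintegral_restrict hfin hΔ hΔm hΔR hΔv hΦ₁,
    hP.lintegral_restrict hfin hΔ hΔm hΔR hΔv hΦ₂]
  refine lintegral_congr fun γ => ?_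
  congr 1
  set b := γ.restrict Δᶜ
  have hM : Measurable fun q : 𝔼 d × Config d =>
      gibbsWeight H R z β Δ hΔ γ (Config.insert q.1 q.2) * F (q.1, q.2.union b) :=
    (hW.comp (measurable_const.prodMk Config.measurable_insert)).mul
      (hF.comp (measurable_fst.prodMk (Config.measurable_union.comp
        (measurable_snd.prodMk measurable_const))))
  calc ∫⁻ γ', gibbsWeight H R z β Δ hΔ γ γ' * Φ₁ (γ', b) ∂(poissonLaw Δ)
      = ∫⁻ γ', ∑' x : γ'.1, gibbsWeight H R z β Δ hΔ γ (Config.insert x (γ'.erase x)) *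
          F (x, (γ'.erase x).union b) ∂(poissonLaw Δ) := by
        refine lintegral_congr fun γ' => ?_
        rw [← ENNReal.tsum_mul_left]
        exact tsum_congr fun x => by rw [Config.insert_erase x.2]
    _ = ∫⁻ γ', (∫⁻ x in Δ, gibbsWeight H R z β Δ hΔ γ (Config.insert x γ') *
          F (x, γ'.union b)) ∂(poissonLaw Δ) := lintegral_tsum_poissonLaw Δ hM
    _ = ∫⁻ γ', gibbsWeight H R z β Δ hΔ γ γ' * Φ₂ (γ', b) ∂(poissonLaw Δ) := by
        refine lintegral_congr fun γ' => ?_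
        have hm : Measurable fun x : 𝔼 d =>
            papangelou H R z β (x, (γ'.restrict Δ).union b) * F (x, γ'.union b) :=
          (hw.comp (measurable_id.prodMk measurable_const)).mul
            (hF.comp (measurable_id.prodMk measurable_const))
        rw [← lintegral_const_mul _ hm]
        have hnull : ∀ᵐ x ∂(volume.restrict Δ), x ∉ γ'.1 :=
          ae_restrict_of_ae (γ'.countable.ae_notMem volume)
        refine lintegral_congr_ae ?_
        filter_upwards [hnull, ae_restrict_mem hΔm] with x hx hxΔ
        rw [gibbsWeight_insert hfin hR hr hz hΔ hxΔ hx, mul_assoc]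
        rfl

/-- The reduced Campbell measure of `P`: the intensity of the pairs `(x, γ \ {x})`, `x ∈ γ`. -/
noncomputable def campbell (P : Measure (Config d)) : Measure (𝔼 d × Config d) :=
  (P.compProd (Config.pointKernel d)).map fun p => (p.2, p.1.erase p.2)

theorem measurable_campbell_map :
    Measurable fun p : Config d × 𝔼 d => (p.2, p.1.erase p.2) :=
  measurable_snd.prodMk (Config.measurable_erase.comp measurable_swap)

theorem lintegral_campbell (P : Measure (Config d)) [SFinite P] {F : 𝔼 d × Config d → ℝ≥0∞}
    (hF : Measurable F) :
    ∫⁻ p, F p ∂(campbell P) = ∫⁻ γ, ∑' x : γ.1, F (x, γ.erase x) ∂P := by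
  have hF' : Measurable fun p : Config d × 𝔼 d => F (p.2, p.1.erase p.2) :=
    hF.comp measurable_campbell_map
  rw [campbell, lintegral_map hF measurable_campbell_map, Measure.lintegral_compProd hF']
  exact lintegral_congr fun γ => Config.lintegral_pointKernel γ fun x => F (x, γ.erase x)

/-- The Georgii–Nguyen–Zessin equation: the reduced Campbell measure of a Gibbs measure has density
`z exp(-β h(x, γ))` with respect to `dx P(dγ)`. -/
theorem IsGibbsMeasure.campbell_eq [NullSingletonClass (volume : Measure (𝔼 d))]
    (hfin : ∀ γ, H.toFun γ ≠ ⊤) (hR : 0 < R) (hr : H.HasFiniteRange R) (hz : 0 < z)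
    {P : Measure (Config d)} (hP : IsGibbsMeasure H R z β P) :
    campbell P = ((volume : Measure (𝔼 d)).prod P).withDensity (papangelou H R z β) := by
  have := hP.isProbabilityMeasure
  have hw := measurable_papangelou (R := R) (z := z) (β := β) hfin
  have hmΔ : ∀ n : ℕ, MeasurableSet (Metric.closedBall (0 : 𝔼 d) (n + 1)) := fun n =>
    Metric.isClosed_closedBall.measurableSet
  have hU : ⋃ n : ℕ, Metric.closedBall (0 : 𝔼 d) (n + 1) ×ˢ (univ : Set (Config d)) = univ := by
    refine eq_univ_of_forall fun p => mem_iUnion.2 ?_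
    obtain ⟨n, hn⟩ := exists_nat_ge ‖p.1‖
    exact ⟨n, by simp only [mem_prod, mem_closedBall_zero_iff, mem_univ, and_true]; linarith⟩
  refine (Measure.ext_iff_of_iUnion_eq_univ hU).2 fun n => Measure.ext fun A hA => ?_
  set Δ := Metric.closedBall (0 : 𝔼 d) (n + 1)
  have hΔ : Bornology.IsBounded Δ := Metric.isBounded_closedBall
  have hΔm : MeasurableSet Δ := hmΔ n
  have hΔv : 0 < volume Δ := Metric.measure_closedBall_pos _ _ (by positivity)
  have hΔR : MeasurableSet (Δ + Metric.closedBall 0 R) :=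
    ((isCompact_closedBall _ _).add (isCompact_closedBall _ _)).isClosed.measurableSet
  have hAΔ : MeasurableSet (A ∩ Δ ×ˢ univ) := hA.inter (hΔm.prod MeasurableSet.univ)
  have hF : Measurable (A.indicator (1 : 𝔼 d × Config d → ℝ≥0∞)) := measurable_one.indicator hA
  have key := hP.lintegral_tsum_window hfin hR hr hz hΔ hΔm hΔR hΔv hF
  rw [Measure.restrict_apply hA, Measure.restrict_apply hA, ← lintegral_indicator_one hAΔ,
    lintegral_campbell P (measurable_one.indicator hAΔ), withDensity_apply _ hAΔ,
    ← lintegral_indicator hAΔ, lintegral_prod_symm' _ (hw.indicator hAΔ)]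
  convert key using 3 with γ γ
  · refine tsum_congr fun x => ?_
    by_cases h1 : (x : 𝔼 d) ∈ Δ <;> by_cases h2 : ((x : 𝔼 d), γ.erase x) ∈ A <;>
      simp [h1, h2]
  · rw [← lintegral_indicator hΔm]
    clear_value Δ
    refine lintegral_congr fun x => ?_
    by_cases h1 : x ∈ Δ <;> by_cases h2 : (x, γ) ∈ A <;> simp [h1, h2]

end GNZ

/-! ### Integration by parts with exceptional points -/

/-- A function with an integrable derivative off a closed discrete set has one-sided
limits: the fundamental theorem of calculus expresses the function as a continuous primitive on
each interval that avoids the exceptional set. -/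
theorem exists_tendsto_nhdsGT {v v' : ℝ → ℝ} {S : Set ℝ} (hS : ∀ x, ∀ᶠ y in 𝓝[≠] x, y ∉ S)
    (hd : ∀ x ∉ S, HasDerivAt v (v' x) x) (hint : Integrable v') (s : ℝ) :
    ∃ L, Tendsto v (𝓝[>] s) (𝓝 L) := by
  have hev : ∀ᶠ y in 𝓝[>] s, y ∉ S :=
    (hS s).filter_mono (nhdsWithin_mono _ fun y (hy : s < y) => hy.ne')
  obtain ⟨b, hb, hbS⟩ := mem_nhdsGT_iff_exists_Ioo_subset.1 hev
  have hsb : s < b := hb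
  obtain ⟨c, hsc, hcb⟩ := exists_between hsb
  have hii : ∀ a b, IntervalIntegrable v' volume a b := fun a b => hint.intervalIntegrable
  have hcont := intervalIntegral.continuous_primitive hii c
  refine ⟨v c + ∫ x in c..s, v' x, ?_⟩
  have ht : Tendsto (fun x => v c + ∫ y in c..x, v' y) (𝓝[>] s)
      (𝓝 (v c + ∫ x in c..s, v' x)) :=
    (tendsto_const_nhds.add (hcont.tendsto s)).mono_left nhdsWithin_le_nhds
  refine ht.congr' ?_
  filter_upwards [Ioo_mem_nhdsGT hsb] with x hx
  have hsub : uIcc c x ⊆ Ioo s b := (convex_Ioo s b).ordConnected.uIcc_subset ⟨hsc, hcb⟩ hx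
  rw [intervalIntegral.integral_eq_sub_of_hasDerivAt (fun y hy => hd y (hbS (hsub hy))) (hii c x)]
  ring

theorem exists_tendsto_nhdsLT {v v' : ℝ → ℝ} {S : Set ℝ} (hS : ∀ x, ∀ᶠ y in 𝓝[≠] x, y ∉ S)
    (hd : ∀ x ∉ S, HasDerivAt v (v' x) x) (hint : Integrable v') (s : ℝ) :
    ∃ L, Tendsto v (𝓝[<] s) (𝓝 L) := by
  have hev : ∀ᶠ y in 𝓝[<] s, y ∉ S :=
    (hS s).filter_mono (nhdsWithin_mono _ fun y (hy : y < s) => hy.ne)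
  obtain ⟨b, hb, hbS⟩ := mem_nhdsLT_iff_exists_Ioo_subset.1 hev
  have hsb : b < s := hb
  obtain ⟨c, hbc, hcs⟩ := exists_between hsb
  have hii : ∀ a b, IntervalIntegrable v' volume a b := fun a b => hint.intervalIntegrable
  have hcont := intervalIntegral.continuous_primitive hii c
  refine ⟨v c + ∫ x in c..s, v' x, ?_⟩
  have ht : Tendsto (fun x => v c + ∫ y in c..x, v' y) (𝓝[<] s)
      (𝓝 (v c + ∫ x in c..s, v' x)) :=
    (tendsto_const_nhds.add (hcont.tendsto s)).mono_left nhdsWithin_le_nhds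
  refine ht.congr' ?_
  filter_upwards [Ioo_mem_nhdsLT hsb] with x hx
  have hsub : uIcc c x ⊆ Ioo b s := (convex_Ioo b s).ordConnected.uIcc_subset ⟨hbc, hcs⟩ hx
  rw [intervalIntegral.integral_eq_sub_of_hasDerivAt (fun y hy => hd y (hbS (hsub hy))) (hii c x)]
  ring

/-- On the line, the integral of the derivative of a compactly supported function vanishes even if
the function is not differentiable on a closed discrete set, provided it does not jump there. -/
theorem integral_deriv_eq_zero_of_no_jump {v v' : ℝ → ℝ} {S : Set ℝ} (hSc : S.Countable)
    (hS : ∀ x, ∀ᶠ y in 𝓝[≠] x, y ∉ S) (hd : ∀ x ∉ S, HasDerivAt v (v' x) x)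
    (hint : Integrable v') {r : ℝ} (hsupp : ∀ x, r < |x| → v x = 0)
    (hjump : ∀ s ∈ S, ∀ a b, Tendsto v (𝓝[<] s) (𝓝 a) → Tendsto v (𝓝[>] s) (𝓝 b) → a = b) :
    ∫ x, v' x = 0 := by
  have hlim : ∀ x, ∃ L, Tendsto v (𝓝[≠] x) (𝓝 L) := by
    intro x
    by_cases hx : x ∈ S
    · obtain ⟨a, ha⟩ := exists_tendsto_nhdsLT hS hd hint x
      obtain ⟨b, hb⟩ := exists_tendsto_nhdsGT hS hd hint x
      have hab := hjump x hx a b ha hb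
      subst hab
      exact ⟨a, by rw [← nhdsLT_sup_nhdsGT]; exact ha.sup hb⟩
    · exact ⟨v x, continuousAt_iff_punctured_nhds.1 (hd x hx).continuousAt⟩
  -- The continuous version of `v`.
  set V : ℝ → ℝ := fun x => limUnder (𝓝[≠] x) v
  have hV : ∀ x, Tendsto v (𝓝[≠] x) (𝓝 (V x)) := fun x => tendsto_nhds_limUnder (hlim x)
  have heq : ∀ x, ContinuousAt v x → V x = v x := fun x hx =>
    tendsto_nhds_unique (hV x) (continuousAt_iff_punctured_nhds.1 hx)
  have heqS : ∀ x ∉ S, V x = v x := fun x hx => heq x (hd x hx).continuousAt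
  have hev : ∀ x, V =ᶠ[𝓝[≠] x] v := fun x => (hS x).mono heqS
  have hcont : Continuous V := continuous_iff_continuousAt.2 fun x =>
    continuousAt_iff_punctured_nhds.2 ((hV x).congr' (hev x).symm)
  have hderiv : ∀ x ∉ S, HasDerivAt V (v' x) x := by
    intro x hx
    refine (hd x hx).congr_of_eventuallyEq ?_
    have h := hev x
    rw [EventuallyEq, eventually_nhdsWithin_iff] at h
    filter_upwards [h] with y hy
    by_cases hyx : y = x
    · rw [hyx, heqS x hx]
    · exact hy hyx
  have hV0 : ∀ x, r < |x| → V x = 0 := by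
    intro x hx
    have hloc : v =ᶠ[𝓝 x] fun _ => 0 := by
      filter_upwards [(isOpen_lt continuous_const continuous_abs).mem_nhds hx] with y hy
      exact hsupp y hy
    rw [heq x (hloc.continuousAt), hsupp x hx]
  have ht := intervalIntegral_tendsto_integral hint
    (tendsto_neg_atTop_atBot.comp tendsto_natCast_atTop_atTop)
    (tendsto_natCast_atTop_atTop (R := ℝ))
  refine tendsto_nhds_unique ht ?_
  refine tendsto_const_nhds.congr' ?_
  obtain ⟨N, hN⟩ := exists_nat_gt r
  filter_upwards [eventually_ge_atTop N] with n hn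
  have hrn : r < n := hN.trans_le (by exact_mod_cast hn)
  rw [integral_eq_of_hasDerivAt_off_countable V v' hSc hcont.continuousOn
    (fun x hx => hderiv x hx.2) hint.intervalIntegrable,
    hV0 n (by rwa [Nat.abs_cast]),
    hV0 _ (by rwa [Function.comp_apply, abs_neg, Nat.abs_cast]), sub_zero]

theorem gradient_apply {d : ℕ} {u : 𝔼 d → ℝ} (x : 𝔼 d) (i : Fin d) :
    gradient u x i = fderiv ℝ u x (EuclideanSpace.single i 1) := by
  have h : inner ℝ (gradient u x) (EuclideanSpace.single i 1) =
      fderiv ℝ u x (EuclideanSpace.single i 1) := by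
    rw [← InnerProductSpace.toDual_apply_apply, toDual_gradient]
  rw [← h, EuclideanSpace.inner_single_right]
  simp

theorem hasDerivAt_comp_line {d : ℕ} {u : 𝔼 d → ℝ} {x : 𝔼 d} {i : Fin d} {t : ℝ}
    (hu : DifferentiableAt ℝ u (x + t • EuclideanSpace.single i 1)) :
    HasDerivAt (fun t : ℝ => u (x + t • EuclideanSpace.single i 1))
      (gradient u (x + t • EuclideanSpace.single i 1) i) t := by
  rw [gradient_apply]
  have h : HasDerivAt (fun t : ℝ => x + t • EuclideanSpace.single i (1 : ℝ))
      (EuclideanSpace.single i 1) t := by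
    simpa using ((hasDerivAt_id t).smul_const (EuclideanSpace.single i (1 : ℝ))).const_add x
  exact hu.hasFDerivAt.comp_hasDerivAt t h

theorem line_injective {d : ℕ} (x : 𝔼 d) (i : Fin d) :
    Function.Injective fun t : ℝ => x + t • EuclideanSpace.single i (1 : ℝ) := by
  intro t t' h
  have := congrArg (fun y : 𝔼 d => y i) h
  simpa using this

theorem tendsto_line {d : ℕ} (x : 𝔼 d) (i : Fin d) (t : ℝ) :
    Tendsto (fun t : ℝ => x + t • EuclideanSpace.single i (1 : ℝ)) (𝓝[≠] t)
      (𝓝[≠] (x + t • EuclideanSpace.single i (1 : ℝ))) := by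
  have hc : Continuous fun t : ℝ => x + t • EuclideanSpace.single i (1 : ℝ) := by fun_prop
  exact tendsto_nhdsWithin_of_tendsto_nhds_of_eventually_within _
    (hc.continuousAt.mono_left nhdsWithin_le_nhds)
    (eventually_nhdsWithin_of_forall fun t' ht' h => ht' (line_injective x i h))

/-- Slicing `ℝ^{n+1}` into lines parallel to the `i`-th axis. -/
theorem measurePreserving_slice {n : ℕ} (i : Fin (n + 1)) :
    MeasurePreserving (fun p : (Fin n → ℝ) × ℝ =>
      (WithLp.toLp 2 (i.insertNth 0 p.1) : 𝔼 (n + 1)) + p.2 • EuclideanSpace.single i (1 : ℝ)) := by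
  have h1 := (volume_preserving_piFinSuccAbove (fun _ : Fin (n + 1) => ℝ) i).symm
  have h2 := ((PiLp.volume_preserving_toLp (Fin (n + 1))).comp h1).comp
    (Measure.measurePreserving_swap (μ := (volume : Measure (Fin n → ℝ)))
      (ν := (volume : Measure ℝ)))
  convert h2 using 1
  swap
  · rfl
  funext p
  ext j
  obtain rfl | ⟨k, rfl⟩ := i.eq_self_or_eq_succAbove j
  · simp
  · simp

/-- In dimension at least two, almost every line parallel to an axis avoids a countable set, so that
the points of `γ` do not matter; in dimension one the absence of jumps at them is needed. -/
theorem integral_gradient_eq_zero {n : ℕ} (γ : Config (n + 1)) {u : 𝔼 (n + 1) → ℝ}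
    (hu : ∀ x ∉ γ.1, DifferentiableAt ℝ u x) (hsupp : HasCompactSupport u)
    (hint : Integrable (gradient u))
    (hjump : n = 0 → ∀ s ∈ γ.1, ∀ a b,
      Tendsto (fun t : ℝ => u (s + t • EuclideanSpace.single 0 (1 : ℝ))) (𝓝[<] 0) (𝓝 a) →
      Tendsto (fun t : ℝ => u (s + t • EuclideanSpace.single 0 (1 : ℝ))) (𝓝[>] 0) (𝓝 b) →
      a = b) :
    ∫ x, gradient u x = 0 := by
  suffices h : ∀ i, ∫ x, gradient u x i = 0 by
    ext i
    have h1 := (EuclideanSpace.proj (𝕜 := ℝ) i).integral_comp_comm hint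
    exact h1.symm.trans (h i)
  intro i
  have hinti : Integrable fun x => gradient u x i :=
    (EuclideanSpace.proj (𝕜 := ℝ) i).integrable_comp hint
  obtain ⟨r, hr⟩ := hsupp.isCompact.isBounded.subset_closedBall 0
  have hmp := measurePreserving_slice i
  set b : (Fin n → ℝ) → 𝔼 (n + 1) := fun w => WithLp.toLp 2 (i.insertNth 0 w)
  have hint' : Integrable (fun p : (Fin n → ℝ) × ℝ =>
      gradient u (b p.1 + p.2 • EuclideanSpace.single i (1 : ℝ)) i) :=
    hmp.integrable_comp_of_integrable hinti
  have hval : ∫ x, gradient u x i = ∫ p : (Fin n → ℝ) × ℝ,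
      gradient u (b p.1 + p.2 • EuclideanSpace.single i (1 : ℝ)) i := by
    have hme := hinti.aestronglyMeasurable
    rw [← hmp.map_eq] at hme ⊢
    exact integral_map hmp.measurable.aemeasurable hme
  rw [hval]
  have hprod : (volume : Measure ((Fin n → ℝ) × ℝ)) = volume.prod volume := rfl
  rw [hprod, integral_prod _ hint']
  refine integral_eq_zero_of_ae ?_
  have hmiss : ∀ᵐ w : Fin n → ℝ, n ≠ 0 →
      ∀ t : ℝ, b w + t • EuclideanSpace.single i (1 : ℝ) ∉ γ.1 := by
    cases n with
    | zero => exact Eventually.of_forall fun w h => absurd rfl h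
    | succ m =>
      have hc : ((fun x : 𝔼 (m + 1 + 1) => fun j => x (i.succAbove j)) '' γ.1).Countable :=
        γ.countable.image _
      filter_upwards [hc.ae_notMem volume] with w hw _ t ht
      refine hw ⟨_, ht, ?_⟩
      funext j
      simp [b]
  filter_upwards [hint'.prod_right_ae, hmiss] with w hw1 hw2
  have hinj := line_injective (b w) i
  refine integral_deriv_eq_zero_of_no_jump
    (v := fun t => u (b w + t • EuclideanSpace.single i (1 : ℝ)))
    (S := (fun t : ℝ => b w + t • EuclideanSpace.single i (1 : ℝ)) ⁻¹' γ.1) (r := r)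
    (γ.countable.preimage hinj)
    (fun t => (tendsto_line (b w) i t).eventually (γ.eventually_notMem _))
    (fun t ht => hasDerivAt_comp_line (hu _ ht)) hw1 ?_ ?_
  · intro t ht
    by_contra hne
    have h1 := hr (subset_tsupport u hne)
    rw [mem_closedBall_zero_iff] at h1
    have h2 := PiLp.norm_apply_le (b w + t • EuclideanSpace.single i (1 : ℝ)) i
    have h3 : (b w + t • EuclideanSpace.single i (1 : ℝ)) i = t := by simp [b]
    rw [h3, Real.norm_eq_abs] at h2
    linarith
  · intro s hs a c ha hc
    have hn : n = 0 := by
      by_contra hn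
      exact hw2 hn s hs
    subst hn
    have hi : i = 0 := Fin.fin_one_eq_zero i
    subst hi
    have hline : ∀ t : ℝ, b w + (t + s) • EuclideanSpace.single 0 (1 : ℝ) =
        (b w + s • EuclideanSpace.single 0 (1 : ℝ)) + t • EuclideanSpace.single 0 (1 : ℝ) := by
      intro t
      rw [add_smul]; abel
    refine hjump rfl _ hs a c ?_ ?_
    · have h1 : Tendsto (fun t : ℝ => t + s) (𝓝[<] 0) (𝓝[<] s) := by
        have := (continuous_add_const s).tendsto' (0 : ℝ) s (zero_add s)
        exact tendsto_nhdsWithin_of_tendsto_nhds_of_eventually_within _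
          (this.mono_left nhdsWithin_le_nhds)
          (eventually_nhdsWithin_of_forall fun t (ht : t < 0) => by
            change t + s < s; linarith)
      refine (ha.comp h1).congr fun t => ?_
      simp only [Function.comp_apply, hline]
    · have h1 : Tendsto (fun t : ℝ => t + s) (𝓝[>] 0) (𝓝[>] s) := by
        have := (continuous_add_const s).tendsto' (0 : ℝ) s (zero_add s)
        exact tendsto_nhdsWithin_of_tendsto_nhds_of_eventually_within _
          (this.mono_left nhdsWithin_le_nhds)
          (eventually_nhdsWithin_of_forall fun t (ht : 0 < t) => by
            change s < t + s; linarith)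
      refine (hc.comp h1).congr fun t => ?_
      simp only [Function.comp_apply, hline]

/-- The gradient of a function that is differentiable in `x`, on a measurable set of pairs, is
jointly measurable, as a limit of difference quotients. -/
theorem measurable_indicator_gradient {d : ℕ} {α : Type*} [MeasurableSpace α]
    {q : 𝔼 d × α → ℝ} (hq : Measurable q) {T : Set (𝔼 d × α)} (hT : MeasurableSet T)
    (hd : ∀ p ∈ T, DifferentiableAt ℝ (fun y => q (y, p.2)) p.1) :
    Measurable (T.indicator fun p => gradient (fun y => q (y, p.2)) p.1) := by
  suffices h : Measurable fun p =>
      WithLp.ofLp (T.indicator (fun p => gradient (fun y => q (y, p.2)) p.1) p) from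
    (WithLp.measurable_toLp 2 _).comp h
  refine measurable_pi_lambda _ fun i => ?_
  refine measurable_of_tendsto_metrizable (f := fun (n : ℕ) => T.indicator fun p =>
    ((n : ℝ) + 1) * (q (p.1 + ((n : ℝ) + 1)⁻¹ • EuclideanSpace.single i 1, p.2) - q p))
    (fun n => ?_) ?_
  · refine Measurable.indicator ?_ hT
    refine ((hq.comp ?_).sub hq).const_mul _
    exact (measurable_fst.add_const _).prodMk measurable_snd
  · refine tendsto_pi_nhds.2 fun p => ?_
    by_cases hp : p ∈ T
    · simp only [indicator_of_mem hp]
      have h1 : DifferentiableAt ℝ (fun y => q (y, p.2))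
          (p.1 + (0 : ℝ) • EuclideanSpace.single i (1 : ℝ)) := by simpa using hd p hp
      have h2 := hasDerivAt_comp_line h1
      have h3 : Tendsto (fun n : ℕ => ((n : ℝ) + 1)⁻¹) atTop (𝓝[≠] 0) :=
        tendsto_nhdsWithin_of_tendsto_nhds_of_eventually_within _
          (by simpa using tendsto_one_div_add_atTop_nhds_zero_nat (𝕜 := ℝ))
          (Eventually.of_forall fun n => by
            change ((n : ℝ) + 1)⁻¹ ≠ 0
            positivity)
      have h4 := h2.tendsto_slope_zero.comp h3
      simpa [Function.comp_def] using h4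
    · simp only [indicator_of_notMem hp]
      exact tendsto_const_nhds

/-! ### Absence of jumps in dimension one -/

theorem ae_notMem_of_campbell_eq_zero {d : ℕ} {P : Measure (Config d)} [SFinite P]
    {N : Set (𝔼 d × Config d)} (hN : MeasurableSet N) (h : campbell P N = 0) :
    ∀ᵐ γ ∂P, ∀ x ∈ γ.1, (x, γ.erase x) ∉ N := by
  have hm : Measurable (N.indicator (1 : 𝔼 d × Config d → ℝ≥0∞)) := measurable_one.indicator hN
  rw [← lintegral_indicator_one hN, lintegral_campbell P hm,
    lintegral_eq_zero_iff (Config.measurable_tsum_erase hm)] at h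
  filter_upwards [h] with γ hγ x hx hxN
  have h1 := ENNReal.tsum_eq_zero.1 hγ ⟨x, hx⟩
  rw [indicator_of_mem hxN] at h1
  exact one_ne_zero h1

/-- A set of pairs whose sections in `x` are countable is not charged by the pairs `(x, γ \ {x})`,
`x ∈ γ`, of a Gibbs point process. -/
theorem IsGibbsMeasure.ae_notMem {d : ℕ} {H : EnergyFunction d} {R z β : ℝ}
    [NullSingletonClass (volume : Measure (𝔼 d))] (hfin : ∀ γ, H.toFun γ ≠ ⊤) (hR : 0 < R)
    (hr : H.HasFiniteRange R) (hz : 0 < z) {P : Measure (Config d)}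
    (hP : IsGibbsMeasure H R z β P) {N : Set (𝔼 d × Config d)} (hN : MeasurableSet N)
    (hc : ∀ γ, {x | (x, γ) ∈ N}.Countable) :
    ∀ᵐ γ ∂P, ∀ x ∈ γ.1, (x, γ.erase x) ∉ N := by
  have := hP.isProbabilityMeasure
  refine ae_notMem_of_campbell_eq_zero hN ?_
  rw [hP.campbell_eq hfin hR hr hz]
  refine withDensity_absolutelyContinuous _ _ ?_
  rw [Measure.prod_apply_symm hN]
  exact (lintegral_congr fun γ => (hc γ).measure_zero volume).trans lintegral_zero

/-- The unit vector of the line. -/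
noncomputable abbrev unitVec : 𝔼 1 := EuclideanSpace.single 0 1

/-- A symmetric function of two points of the line cannot have a jump on the diagonal that is uniform
on an uncountable set: two points of the set close to each other see the two sides of the jump in the
same value. -/
theorem countable_of_symmetric_jump {K : 𝔼 1 → 𝔼 1 → ℝ} (B : Set (𝔼 1))
    (hsymm : ∀ x ∈ B, ∀ y ∈ B, x ≠ y → K x y = K y x)
    (hcont : ∀ x ∈ B, ∀ y ∈ B, x ≠ y → ContinuousAt (K x) y)
    {δ c r r' : ℝ} (hδ : 0 < δ) (hrr : r < r')
    (hright : ∀ x ∈ B, ∀ ε : ℚ, 0 < (ε : ℝ) → (ε : ℝ) < δ →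
      |K x (x + (ε : ℝ) • unitVec) - c| ≤ r)
    (hleft : ∀ x ∈ B, ∀ ε : ℚ, 0 < (ε : ℝ) → (ε : ℝ) < δ →
      r' ≤ |K x (x + (-(ε : ℝ)) • unitVec) - c|) :
    B.Countable := by
  have hne : ∀ t t' : ℝ, t ≠ t' → t • unitVec ≠ t' • unitVec := by
    intro t t' h h'
    have := congrArg (fun y : 𝔼 1 => y 0) h'
    exact h (by simpa using this)
  have hc : ∀ (x y : 𝔼 1) (σ ε₀ : ℝ), x ∈ B → y ∈ B → x ≠ y → y = x + (σ * ε₀) • unitVec →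
      ContinuousAt (fun ε : ℝ => |K x (x + (σ * ε) • unitVec) - c|) ε₀ := by
    intro x y σ ε₀ hx hy hxy hyx
    have h1 : ContinuousAt (fun ε : ℝ => x + (σ * ε) • unitVec) ε₀ := by fun_prop
    have h2 : ContinuousAt (K x) (x + (σ * ε₀) • unitVec) := hyx ▸ hcont x hx y hy hxy
    exact ((ContinuousAt.comp (f := fun ε : ℝ => x + (σ * ε) • unitVec) h2 h1).sub
      continuousAt_const).abs
  -- Rational increments suffice, by continuity away from the diagonal.
  have hfreq : ∀ (p : ℝ → Prop) (ε₀ : ℝ), 0 < ε₀ → ε₀ < δ → (∀ᶠ ε in 𝓝 ε₀, p ε) →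
      ∃ ε : ℚ, 0 < (ε : ℝ) ∧ (ε : ℝ) < δ ∧ p ε := by
    intro p ε₀ h0 h1 hp
    obtain ⟨ε, hε⟩ := Rat.denseRange_cast (𝕜 := ℝ).exists_mem_open isOpen_interior
      ⟨ε₀, mem_interior_iff_mem_nhds.2 (inter_mem (Ioo_mem_nhds h0 h1) hp)⟩
    have hε' := interior_subset hε
    exact ⟨ε, hε'.1.1, hε'.1.2, hε'.2⟩
  set T : Set ℝ := {t | t • unitVec ∈ B}
  have hsep : ∀ t ∈ T, T ∩ Ioo t (t + δ) = ∅ := by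
    intro t ht
    refine eq_empty_of_forall_notMem fun t' ⟨ht', h1, h2⟩ => ?_
    have hx : t • unitVec ∈ B := ht
    have hy : t' • unitVec ∈ B := ht'
    have hxy := hne t t' h1.ne
    have e1 : t' • unitVec = t • unitVec + (1 * (t' - t)) • unitVec := by
      rw [← add_smul]; congr 1; ring
    have e2 : t • unitVec = t' • unitVec + (-1 * (t' - t)) • unitVec := by
      rw [← add_smul]; congr 1; ring
    have k1 : |K (t • unitVec) (t' • unitVec) - c| ≤ r := by
      by_contra! hlt
      have hca := hc _ _ 1 (t' - t) hx hy hxy e1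
      have hlt' : r < |K (t • unitVec) (t • unitVec + (1 * (t' - t)) • unitVec) - c| := by
        rwa [← e1]
      obtain ⟨ε, h3, h4, h5⟩ := hfreq _ (t' - t) (by linarith) (by linarith)
        (hca.eventually (lt_mem_nhds hlt'))
      rw [one_mul] at h5
      exact absurd (hright _ hx ε h3 h4) (not_le.2 h5)
    have k2 : r' ≤ |K (t' • unitVec) (t • unitVec) - c| := by
      by_contra! hlt
      have hca := hc _ _ (-1) (t' - t) hy hx hxy.symm e2
      have hlt' : |K (t' • unitVec) (t' • unitVec + (-1 * (t' - t)) • unitVec) - c| < r' := by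
        rwa [← e2]
      obtain ⟨ε, h3, h4, h5⟩ := hfreq _ (t' - t) (by linarith) (by linarith)
        (hca.eventually (gt_mem_nhds hlt'))
      rw [neg_one_mul] at h5
      exact absurd (hleft _ hy ε h3 h4) (not_le.2 h5)
    rw [hsymm _ hx _ hy hxy] at k1
    linarith
  have hTc : T.Countable := by
    refine (countable_setOfPred_isolated_right_within (s := T)).mono fun t ht => ?_
    refine ⟨ht, empty_mem_iff_bot.1 (mem_nhdsWithin.2 ⟨Iio (t + δ), isOpen_Iio, ?_, ?_⟩)⟩
    · exact lt_add_of_pos_right t hδ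
    · rintro t' ⟨h1, h2, h3⟩
      exact (hsep t ht).subset ⟨h2, h3, h1⟩
  refine (hTc.image fun t => t • unitVec).mono fun x hx => ?_
  have e : x 0 • unitVec = x := by
    ext i
    rw [Fin.fin_one_eq_zero i]
    simp
  exact ⟨x 0, by change x 0 • unitVec ∈ B; rwa [e], e⟩

/-- On the line, almost surely `exp(-β h(·, Γ))` does not jump at the points of `Γ`. -/
theorem IsGibbsMeasure.ae_no_jump {H : EnergyFunction 1} {R z β : ℝ}
    (hfin : ∀ γ, H.toFun γ ≠ ⊤) (hR : 0 < R) (hr : H.HasFiniteRange R) (hz : 0 < z)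
    (hdiff : ∀ (γ : Config 1) (x : 𝔼 1), x ∉ γ.1 →
      DifferentiableAt ℝ (fun y => (H.pointEnergy R y γ).toReal) x)
    {P : Measure (Config 1)} (hP : IsGibbsMeasure H R z β P) :
    ∀ᵐ γ ∂P, ∀ s ∈ γ.1, ∀ a b,
      Tendsto (fun t : ℝ => Real.exp (-(β * (H.pointEnergy R (s + t • unitVec) γ).toReal)))
        (𝓝[<] 0) (𝓝 a) →
      Tendsto (fun t : ℝ => Real.exp (-(β * (H.pointEnergy R (s + t • unitVec) γ).toReal)))
        (𝓝[>] 0) (𝓝 b) → a = b := by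
  -- The factor `exp(-β h(s, η))` makes the function symmetric in the two points.
  set K : Config 1 → 𝔼 1 → 𝔼 1 → ℝ := fun η s x => Real.exp (-(β *
    ((H.pointEnergy R x (Config.insert s η)).toReal + (H.pointEnergy R s η).toReal)))
  have hKm : ∀ t : ℝ, Measurable fun p : 𝔼 1 × Config 1 => K p.2 p.1 (p.1 + t • unitVec) := by
    intro t
    have hh := EnergyFunction.measurable_pointEnergy hfin R
    have h1 : Measurable fun p : 𝔼 1 × Config 1 =>
        (H.pointEnergy R (p.1 + t • unitVec) (Config.insert p.1 p.2)).toReal :=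
      hh.comp ((measurable_fst.add_const _).prodMk Config.measurable_insert)
    exact (((h1.add hh).const_mul β).neg).exp
  set N : ℕ → ℚ → ℚ → ℚ → Set (𝔼 1 × Config 1) := fun n c r r' =>
    {p | p.1 ∉ p.2.1 ∧ r < r' ∧ ∀ ε : ℚ, 0 < (ε : ℝ) → (ε : ℝ) < ((n : ℝ) + 1)⁻¹ →
      |K p.2 p.1 (p.1 + (ε : ℝ) • unitVec) - c| ≤ r ∧
      (r' : ℝ) ≤ |K p.2 p.1 (p.1 + (-(ε : ℝ)) • unitVec) - c|}
  have hNm : ∀ n c r r', MeasurableSet (N n c r r') := by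
    intro n c r r'
    have hN : N n c r r' = {p : 𝔼 1 × Config 1 | p.1 ∈ p.2.1}ᶜ ∩ ({_p | r < r'} ∩
        ⋂ ε : ℚ, ⋂ _ : 0 < (ε : ℝ), ⋂ _ : (ε : ℝ) < ((n : ℝ) + 1)⁻¹,
          ({p | |K p.2 p.1 (p.1 + (ε : ℝ) • unitVec) - c| ≤ r} ∩
            {p | (r' : ℝ) ≤ |K p.2 p.1 (p.1 + (-(ε : ℝ)) • unitVec) - c|})) := by
      ext p
      simp only [N, mem_inter_iff, mem_compl_iff, mem_iInter, mem_ofPred_eq]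
    rw [hN]
    refine Config.measurableSet_mem.compl.inter ((MeasurableSet.const _).inter ?_)
    refine MeasurableSet.iInter fun ε => MeasurableSet.iInter fun _ => MeasurableSet.iInter
      fun _ => MeasurableSet.inter ?_ ?_
    · exact measurableSet_le ((hKm ε).sub_const _).abs measurable_const
    · exact measurableSet_le measurable_const ((hKm (-ε)).sub_const _).abs
  have hNc : ∀ n c r r', ∀ η, {x | (x, η) ∈ N n c r r'}.Countable := by
    intro n c r r' η
    by_cases hrr : r < r'
    · refine countable_of_symmetric_jump (K := K η) _ ?_ ?_ (δ := ((n : ℝ) + 1)⁻¹)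
        (by positivity) (Rat.cast_lt.2 hrr : (r : ℝ) < r')
        (fun x hx ε h1 h2 => (hx.2.2 ε h1 h2).1) (fun x hx ε h1 h2 => (hx.2.2 ε h1 h2).2)
      · intro x hx y hy hxy
        simp only [K]
        rw [EnergyFunction.pointEnergy_add_comm hfin hR hr hxy hx.1 hy.1]
      · intro x hx y hy hxy
        have hy' : y ∉ (Config.insert x η).1 := by
          rintro (h | h)
          exacts [hxy h.symm, hy.1 h]
        have h1 := (hdiff _ y hy').continuousAt
        exact Real.continuous_exp.continuousAt.comp
          ((h1.add continuousAt_const).const_mul β).neg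
    · convert Set.countable_empty
      exact eq_empty_of_forall_notMem fun x hx => hrr hx.2.1
  have hae : ∀ᵐ γ ∂P, ∀ n c r r', ∀ x ∈ γ.1, (x, γ.erase x) ∉ N n c r r' := by
    simp only [ae_all_iff]
    exact fun n c r r' => hP.ae_notMem hfin hR hr hz (hNm n c r r') (hNc n c r r')
  filter_upwards [hae] with γ hγ s hs a b ha hb
  by_contra hab
  set η := γ.erase s
  have hins : Config.insert s η = γ := Config.insert_erase hs
  set k := Real.exp (-(β * (H.pointEnergy R s η).toReal))
  have hk : 0 < k := Real.exp_pos _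
  have hKeq : ∀ x, K η s x = Real.exp (-(β * (H.pointEnergy R x γ).toReal)) * k := by
    intro x
    simp only [K, k, hins, mul_add, neg_add, Real.exp_add]
  have ha' : Tendsto (fun t : ℝ => K η s (s + t • unitVec)) (𝓝[<] 0) (𝓝 (a * k)) := by
    simp only [hKeq]
    exact ha.mul_const k
  have hb' : Tendsto (fun t : ℝ => K η s (s + t • unitVec)) (𝓝[>] 0) (𝓝 (b * k)) := by
    simp only [hKeq]
    exact hb.mul_const k
  have hab' : 0 < |a * k - b * k| :=
    abs_pos.2 (sub_ne_zero.2 fun h => hab (mul_right_cancel₀ hk.ne' h))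
  -- A rational centre that is closer to the right limit than to the left limit.
  obtain ⟨c, hc⟩ := Rat.denseRange_cast (𝕜 := ℝ).exists_dist_lt (b * k) (half_pos hab')
  rw [Real.dist_eq] at hc
  have hcab : |b * k - c| < |a * k - c| := by
    have h1 := abs_sub_le (a * k) (c : ℝ) (b * k)
    have h2 := abs_sub_comm (c : ℝ) (b * k)
    linarith
  obtain ⟨r, hr1, hr2⟩ := exists_rat_btwn hcab
  obtain ⟨r', hr3, hr4⟩ := exists_rat_btwn hr2
  have hev1 : ∀ᶠ t in 𝓝[>] (0 : ℝ), |K η s (s + t • unitVec) - c| < r :=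
    (hb'.sub_const (c : ℝ)).abs.eventually (gt_mem_nhds hr1)
  have hev2 : ∀ᶠ t in 𝓝[<] (0 : ℝ), r' < |K η s (s + t • unitVec) - c| :=
    (ha'.sub_const (c : ℝ)).abs.eventually (lt_mem_nhds hr4)
  obtain ⟨u, hu, hu'⟩ := mem_nhdsGT_iff_exists_Ioo_subset.1 hev1
  obtain ⟨l, hl, hl'⟩ := mem_nhdsLT_iff_exists_Ioo_subset.1 hev2
  have hu0 : 0 < u := hu
  have hl0 : l < 0 := hl
  obtain ⟨n, hn⟩ := exists_nat_one_div_lt (lt_min hu0 (neg_pos.2 hl0))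
  rw [one_div] at hn
  refine hγ n c r r' s hs ⟨Config.notMem_erase γ s, Rat.cast_lt.1 hr3, fun ε h1 h2 => ⟨?_, ?_⟩⟩
  · have h3 : (ε : ℝ) ∈ Ioo 0 u := ⟨h1, h2.trans (hn.trans_le (min_le_left _ _))⟩
    exact (hu' h3).le
  · have h3 : -(ε : ℝ) ∈ Ioo l 0 :=
      ⟨by linarith [h2.trans (hn.trans_le (min_le_right _ _))], by linarith⟩
    exact (hl' h3).le

/-! ### The integration by parts formula -/

section Main

variable {d : ℕ}

/-- Sums over the points of a point process as integrals against its reduced Campbell measure. -/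
theorem integral_tsum_eq_integral_campbell {Ω : Type*} [MeasurableSpace Ω] {μ : Measure Ω}
    [IsProbabilityMeasure μ] {Γ : Ω → Config d} (hΓ : Measurable Γ) {F : 𝔼 d × Config d → 𝔼 d}
    (hFm : Measurable F) (hF : Integrable F (campbell (μ.map Γ))) :
    ∫ ω, ∑' x : (Γ ω).1, F (x, (Γ ω).erase x) ∂μ = ∫ p, F p ∂(campbell (μ.map Γ)) := by
  have hmap := measurable_campbell_map (d := d)
  have : IsProbabilityMeasure (μ.map Γ) := Measure.isProbabilityMeasure_map hΓ.aemeasurable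
  have hF' : Integrable (fun p : Config d × 𝔼 d => F (p.2, p.1.erase p.2))
      ((μ.map Γ).compProd (Config.pointKernel d)) := hF.comp_measurable hmap
  have h1 : ∫ p, F p ∂(campbell (μ.map Γ)) =
      ∫ p : Config d × 𝔼 d, F (p.2, p.1.erase p.2)
        ∂((μ.map Γ).compProd (Config.pointKernel d)) :=
    integral_map hmap.aemeasurable hF.aestronglyMeasurable
  have hm : StronglyMeasurable fun γ : Config d =>
      ∫ x, F (x, γ.erase x) ∂(Config.pointKernel d γ) :=
    (hFm.comp hmap).stronglyMeasurable.integral_kernel_prod_right'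
  rw [h1, Measure.integral_compProd hF', integral_map hΓ.aemeasurable hm.aestronglyMeasurable]
  refine integral_congr_ae ?_
  have hae := ae_of_ae_map hΓ.aemeasurable
    ((Measure.integrable_compProd_iff hF'.aestronglyMeasurable).1 hF').1
  filter_upwards [hae] with ω hω
  rw [Config.pointKernel_apply] at hω ⊢
  rw [setIntegral_countable _ (Γ ω).countable hω]
  simp [Measure.real]

theorem integrable_campbell {Ω : Type*} [MeasurableSpace Ω] {μ : Measure Ω}
    [IsProbabilityMeasure μ] {Γ : Ω → Config d} (hΓ : Measurable Γ) {F : 𝔼 d × Config d → 𝔼 d}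
    (hF : Measurable F) (h : ∫⁻ ω, ∑' x : (Γ ω).1, ‖F (x, (Γ ω).erase x)‖ₑ ∂μ < ⊤) :
    Integrable F (campbell (μ.map Γ)) := by
  have : IsProbabilityMeasure (μ.map Γ) := Measure.isProbabilityMeasure_map hΓ.aemeasurable
  refine ⟨hF.aestronglyMeasurable, ?_⟩
  rw [HasFiniteIntegral, lintegral_campbell _ hF.enorm,
    lintegral_map (Config.measurable_tsum_erase hF.enorm) hΓ]
  exact h

theorem gradient_mul_exp {f h : 𝔼 d → ℝ} {β : ℝ} {x : 𝔼 d} (hf : DifferentiableAt ℝ f x)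
    (hh : DifferentiableAt ℝ h x) :
    gradient (fun y => f y * Real.exp (-(β * h y))) x =
      Real.exp (-(β * h x)) • (gradient f x - β • (f x • gradient h x)) := by
  ext i
  have h1 : HasFDerivAt (fun y => f y * Real.exp (-(β * h y))) _ x :=
    hf.hasFDerivAt.mul ((hh.hasFDerivAt.const_mul β).neg.exp)
  rw [gradient_apply, HasFDerivAt.fderiv h1]
  simp only [PiLp.smul_apply, PiLp.sub_apply, gradient_apply, smul_eq_mul]
  simp
  ring

/-- For almost every `γ`, the function `f(·, γ) exp(-β h(·, γ))` has zero mean gradient. -/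
theorem IsGibbsMeasure.ae_integral_eq_zero {n : ℕ} {H : EnergyFunction (n + 1)} {R z β : ℝ}
    (hfin : ∀ γ, H.toFun γ ≠ ⊤) (hR : 0 < R) (hr : H.HasFiniteRange R) (hz : 0 < z) (hβ : 0 ≤ β)
    (hdiff : ∀ (γ : Config (n + 1)) (x : 𝔼 (n + 1)), x ∉ γ.1 →
      DifferentiableAt ℝ (fun y => (H.pointEnergy R y γ).toReal) x)
    {P : Measure (Config (n + 1))} (hP : IsGibbsMeasure H R z β P)
    {f : 𝔼 (n + 1) → Config (n + 1) → ℝ} (hf_diff : ∀ γ, Differentiable ℝ fun x => f x γ)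
    (hf_supp : ∀ γ, HasCompactSupport fun x => f x γ) :
    ∀ᵐ γ ∂P,
      Integrable (gradient fun y => f y γ * Real.exp (-(β * (H.pointEnergy R y γ).toReal))) →
      ∫ x, gradient (fun y => f y γ * Real.exp (-(β * (H.pointEnergy R y γ).toReal))) x = 0 := by
  have hjump : ∀ᵐ γ ∂P, n = 0 → ∀ s ∈ γ.1, ∀ a b,
      Tendsto (fun t : ℝ => Real.exp (-(β * (H.pointEnergy R
        (s + t • EuclideanSpace.single 0 (1 : ℝ)) γ).toReal))) (𝓝[<] 0) (𝓝 a) →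
      Tendsto (fun t : ℝ => Real.exp (-(β * (H.pointEnergy R
        (s + t • EuclideanSpace.single 0 (1 : ℝ)) γ).toReal))) (𝓝[>] 0) (𝓝 b) → a = b := by
    cases n with
    | zero =>
      filter_upwards [hP.ae_no_jump hfin hR hr hz hdiff] with γ hγ _
      exact hγ
    | succ m => exact Eventually.of_forall fun γ h => absurd h (Nat.succ_ne_zero m)
  filter_upwards [hjump] with γ hγ hint
  refine integral_gradient_eq_zero γ (fun x hx => ?_) (hf_supp γ).mul_right hint ?_
  · exact (hf_diff γ x).mul (((hdiff γ x hx).const_mul β).neg.exp)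
  intro hn s hs a b ha hb
  set g : ℝ → ℝ := fun t => Real.exp (-(β * (H.pointEnergy R
    (s + t • EuclideanSpace.single 0 (1 : ℝ)) γ).toReal))
  set fl : ℝ → ℝ := fun t => f (s + t • EuclideanSpace.single 0 (1 : ℝ)) γ
  have hfl : Tendsto fl (𝓝 0) (𝓝 (f s γ)) := by
    have hc : Continuous fl := (hf_diff γ).continuous.comp (by fun_prop)
    simpa [fl] using hc.tendsto 0
  have ha : Tendsto (fun t => fl t * g t) (𝓝[<] 0) (𝓝 a) := ha
  have hb : Tendsto (fun t => fl t * g t) (𝓝[>] 0) (𝓝 b) := hb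
  by_cases hfs : f s γ = 0
  · -- Near `s` the factor `exp(-β h)` is bounded, by stability.
    obtain ⟨C, hC⟩ := EnergyFunction.exists_le_pointEnergy hfin hR hr γ s
    have hline : Tendsto (fun t : ℝ => s + t • EuclideanSpace.single (0 : Fin (n + 1)) (1 : ℝ))
        (𝓝[≠] 0) (𝓝[≠] s) := by
      simpa using tendsto_line s 0 0
    have hbd : ∀ᶠ t in 𝓝[≠] (0 : ℝ), ‖g t‖ ≤ Real.exp (-(β * C)) := by
      filter_upwards [hline.eventually (γ.eventually_notMem s), hline.eventually
        (mem_nhdsWithin_of_mem_nhds (Metric.closedBall_mem_nhds s one_pos))] with t ht1 ht2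
      rw [Real.norm_eq_abs, Real.abs_exp]
      exact Real.exp_le_exp.2 (neg_le_neg (mul_le_mul_of_nonneg_left (hC _ ht2 ht1) hβ))
    have h0 : Tendsto (fun t => fl t * g t) (𝓝[≠] 0) (𝓝 0) := by
      rw [hfs] at hfl
      exact (hfl.mono_left nhdsWithin_le_nhds).zero_mul_isBoundedUnder_le
        (isBoundedUnder_of_eventually_le hbd)
    have h1 := tendsto_nhds_unique ha
      (h0.mono_left (nhdsWithin_mono _ fun t (ht : t < 0) => ht.ne))
    have h2 := tendsto_nhds_unique hb
      (h0.mono_left (nhdsWithin_mono _ fun t (ht : 0 < t) => ht.ne'))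
    rw [h1, h2]
  · have hdiv : ∀ {l : Filter ℝ} {c : ℝ}, l ≤ 𝓝 0 → Tendsto (fun t => fl t * g t) l (𝓝 c) →
        Tendsto g l (𝓝 (c / f s γ)) := by
      intro l c hl hc
      have hfl' := hfl.mono_left hl
      refine (hc.div hfl' hfs).congr' ?_
      filter_upwards [hfl'.eventually_ne hfs] with t ht
      exact mul_div_cancel_left₀ _ ht
    have h1 := hγ hn s hs _ _ (hdiv nhdsWithin_le_nhds ha) (hdiv nhdsWithin_le_nhds hb)
    exact (div_left_inj' hfs).1 h1

end Main

end GibbsPP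

theorem mainTheorem9 {d : ℕ} (H : GibbsPP.EnergyFunction d) (R z β : ℝ)
    (hR : 0 < R) (hz : 0 < z) (hβ : 0 ≤ β)
    (hH_stat : H.IsStationary) (hH_range : H.HasFiniteRange R)
    {Ω : Type*} [MeasurableSpace Ω] (ℙ : Measure Ω) [IsProbabilityMeasure ℙ]
    (Γ : Ω → GibbsPP.Config d) (hΓ : Measurable Γ)
    (hΓ_gibbs : GibbsPP.IsGibbsMeasure H R z β (ℙ.map Γ))
    (hh : ∀ (γ : GibbsPP.Config d) (x : EuclideanSpace ℝ (Fin d)), x ∉ γ.1 →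
      H.pointEnergy R x γ ≠ ⊤ ∧
        DifferentiableAt ℝ (fun y => (H.pointEnergy R y γ).toReal) x)
    (f : EuclideanSpace ℝ (Fin d) → GibbsPP.Config d → ℝ)
    (hf_meas : Measurable (Function.uncurry f))
    (hf_diff : ∀ γ, Differentiable ℝ fun x => f x γ)
    (hf_supp : ∀ γ, HasCompactSupport fun x => f x γ)
    (hint₁ : ∫⁻ ω, ∑' x : (Γ ω).1,
      ‖gradient (fun y => f y ((Γ ω).erase x)) x‖ₑ ∂ℙ < ⊤)
    (hint₂ : ∫⁻ ω, ∑' x : (Γ ω).1,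
      ‖f x ((Γ ω).erase x) •
        gradient (fun y => (H.pointEnergy R y ((Γ ω).erase x)).toReal) x‖ₑ ∂ℙ < ⊤) :
    ∫ ω, ∑' x : (Γ ω).1, gradient (fun y => f y ((Γ ω).erase x)) x ∂ℙ =
      β • ∫ ω, ∑' x : (Γ ω).1, f x ((Γ ω).erase x) •
        gradient (fun y => (H.pointEnergy R y ((Γ ω).erase x)).toReal) x ∂ℙ := by
  cases d with
  | zero => exact Subsingleton.elim _ _
  | succ n =>
  have hfin := GibbsPP.EnergyFunction.ne_top_of_pointEnergy_ne_top hR hH_range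
    fun γ x hx => (hh γ x hx).1
  have hdiff := fun (γ : GibbsPP.Config (n + 1)) x hx => (hh γ x hx).2
  have hprob := hΓ_gibbs.isProbabilityMeasure
  set T : Set (EuclideanSpace ℝ (Fin (n + 1)) × GibbsPP.Config (n + 1)) := {p | p.1 ∉ p.2.1}
  have hT : MeasurableSet T := GibbsPP.Config.measurableSet_mem.compl
  set F₁ : EuclideanSpace ℝ (Fin (n + 1)) × GibbsPP.Config (n + 1) →
    EuclideanSpace ℝ (Fin (n + 1)) := fun p => gradient (fun y => f y p.2) p.1
  -- At the points of the configuration, where it has no meaning, the gradient of `h` is set to `0`.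
  set F₂ : EuclideanSpace ℝ (Fin (n + 1)) × GibbsPP.Config (n + 1) →
    EuclideanSpace ℝ (Fin (n + 1)) := fun p =>
      f p.1 p.2 • T.indicator (fun p => gradient (fun y => (H.pointEnergy R y p.2).toReal) p.1) p
  have hF₁ : Measurable F₁ := by
    have := GibbsPP.measurable_indicator_gradient hf_meas MeasurableSet.univ
      fun p _ => hf_diff p.2 p.1
    rwa [indicator_univ] at this
  have hF₂ : Measurable F₂ := hf_meas.smul (GibbsPP.measurable_indicator_gradient
    (GibbsPP.EnergyFunction.measurable_pointEnergy hfin R) hT fun p hp => hdiff p.2 p.1 hp)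
  have hF₂_erase : ∀ (γ : GibbsPP.Config (n + 1)) (x : EuclideanSpace ℝ (Fin (n + 1))),
      f x (γ.erase x) • gradient (fun y => (H.pointEnergy R y (γ.erase x)).toReal) x =
        F₂ (x, γ.erase x) := by
    intro γ x
    simp only [F₂]
    rw [indicator_of_mem (show (x, γ.erase x) ∈ T from GibbsPP.Config.notMem_erase γ x)]
  simp only [hF₂_erase] at hint₂ ⊢
  have hI₁ := GibbsPP.integrable_campbell hΓ hF₁ hint₁
  have hI₂ := GibbsPP.integrable_campbell hΓ hF₂ hint₂
  have e₁ := GibbsPP.integral_tsum_eq_integral_campbell hΓ hF₁ hI₁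
  have e₂ := GibbsPP.integral_tsum_eq_integral_campbell hΓ hF₂ hI₂
  refine e₁.trans (Eq.trans ?_ (congrArg (fun v => β • v) e₂.symm))
  have hI₃ : Integrable (fun p => β • F₂ p) (GibbsPP.campbell (ℙ.map Γ)) := hI₂.smul β
  rw [← integral_smul, ← sub_eq_zero, ← integral_sub hI₁ hI₃]
  have hI : Integrable (fun p => F₁ p - β • F₂ p) (GibbsPP.campbell (ℙ.map Γ)) :=
    hI₁.sub hI₃
  have hw := GibbsPP.measurable_papangelou (R := R) (z := z) (β := β) hfin
  have hw_top : ∀ᵐ p ∂((volume : Measure (EuclideanSpace ℝ (Fin (n + 1)))).prod (ℙ.map Γ)),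
      GibbsPP.papangelou H R z β p < ⊤ := ae_of_all _ fun p => ENNReal.ofReal_lt_top
  rw [hΓ_gibbs.campbell_eq hfin hR hH_range hz] at hI ⊢
  rw [integrable_withDensity_iff_integrable_smul' hw hw_top] at hI
  rw [integral_withDensity_eq_integral_toReal_smul hw hw_top, integral_prod_symm _ hI]
  refine integral_eq_zero_of_ae ?_
  filter_upwards [hI.prod_left_ae, hΓ_gibbs.ae_integral_eq_zero hfin hR hH_range hz hβ hdiff
    hf_diff hf_supp] with γ hγ₁ hγ₂
  have heq : (fun x => (GibbsPP.papangelou H R z β (x, γ)).toReal • (F₁ (x, γ) - β • F₂ (x, γ)))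
      =ᵐ[volume] fun x => z • gradient
        (fun y => f y γ * Real.exp (-(β * (H.pointEnergy R y γ).toReal))) x := by
    filter_upwards [γ.countable.ae_notMem volume] with x hx
    have hw_real : (GibbsPP.papangelou H R z β (x, γ)).toReal =
        z * Real.exp (-(β * (H.pointEnergy R x γ).toReal)) :=
      ENNReal.toReal_ofReal (mul_pos hz (Real.exp_pos _)).le
    rw [GibbsPP.gradient_mul_exp (hf_diff γ x) (hdiff γ x hx), hw_real, mul_smul]
    simp only [F₁, F₂]
    rw [indicator_of_mem (show (x, γ) ∈ T from hx)]
  have hint : Integrable (gradient fun y => f y γ *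
      Real.exp (-(β * (H.pointEnergy R y γ).toReal))) := by
    exact (integrable_smul_iff hz.ne' _).1 (hγ₁.congr heq)
  refine (integral_congr_ae heq).trans ?_
  rw [integral_smul, hγ₂ hint, smul_zero]
  rfl
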